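/- Let $I$ be a countable index set. For each $v\in I$ let $A_v$ be a $C^*$-algebra with a distinguished projection $p_v\in A_v$, where $p_v\neq 0$ for all but finitely many $v$. Let $X_v$ be a right Hilbert $C^*$-module over $A_v$ with a distinguished vector $x_v\in X_v$, such that $\langle x_v,x_v\rangle_v=p_v$ for all but finitely many $v$ (that is, $(X_v,x_v)_{v\in I}$ is a compatible collection over $(A_v,p_v)_{v\in I}$). For Hilbert spaces $\mathcal H_v$ with vectors $h_v\in\mathcal H_v$ such that $\|h_v\|=1$ for all but finitely many $v$, let $\bigotimes'_v(\mathcal H_v,h_v)$ be the completion of the span of the simple tensors $\otimes_v e_v$ (with $e_v=h_v$ for all but finitely many $v$) for the inner product $\langle\otimes_v e_v,\otimes_v f_v\rangle=\prod_v\langle e_v,f_v\rangle$. Let $A:=\bigotimes'_v(A_v,p_v)$ be the $C^*$-algebra obtained as the completion of the union $A_0$ of the spatial tensor products $A_S=\bigotimes_{v\in S}A_v$ over the finite sets $S\subseteq I$ containing all $v$ with $p_v=0$, along the embeddings $a\mapsto a\otimes p_k$; it is the closed span of the simple tensors $\otimes_v a_v$ with $a_v=p_v$ for all but finitely many $v$.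 Let $X:=\bigotimes'_v(X_v,x_v)$ be the restricted tensor product of the compatible collection, i.e. the right Hilbert $A$-module obtained as the completion of the span $X_0$ of the simple tensors $\otimes_v w_v$ (with $w_v=x_v$ for all but finitely many $v$), with right action $(\otimes_v w_v)(\otimes_v a_v)=\otimes_v(w_va_v)$, for the norm $\|\langle w,w\rangle\|^{1/2}$ given by the $A$-valued inner product $\langle\otimes_v w_v,\otimes_v z_v\rangle=\otimes_v\langle w_v,z_v\rangle_v$. For a representation $\rho:B\to\mathbb B(\mathcal K)$ of a $C^*$-algebra $B$ and a right Hilbert $B$-module $Y$, let $Y\otimes_B\mathcal K$ denote the interior tensor product, i.e. the Hilbert space generated by the tensors $y\otimes k$ with $\langle y\otimes k,y'\otimes k'\rangle=\langle k,\rho(\langle y,y'\rangle)k'\rangle$. Let $(\pi,\mathcal H)\simeq\left(\bigotimes'_v\pi_v,\bigotimes'_v(\mathcal H_v,h_v)\right)$ be a factorizable representation of $A$: here $(\pi_v,\mathcal H_v)$ is a representation of $A_v$ for each $v$, $h_v\in\mathcal H_v$ satisfies $\|h_v\|=1$ and $\pi_v(p_v)h_v=h_v$ for all but finitely many $v$,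 and the given unitary equivalence identifies $\mathcal H$ with $\bigotimes'_v(\mathcal H_v,h_v)$ in such a way that $\pi(\otimes_v a_v)(\otimes_v y_v)=\otimes_v\pi_v(a_v)y_v$ for all simple tensors. Then $x_v\otimes h_v\in X_v\otimes_{A_v}\mathcal H_v$ is a unit vector for all but finitely many $v$, and there is a unique unitary isomorphism $$X\otimes_A\mathcal H\;\simeq\;\bigotimes_{v\in I}{}'\left(X_v\otimes_{A_v}\mathcal H_v,\;x_v\otimes h_v\right)$$ such that $$(\otimes_v w_v)\otimes(\otimes_v y_v)\;\mapsto\;\otimes_v(w_v\otimes y_v)$$ for all simple tensors $\otimes_v w_v\in X$ and $\otimes_v y_v\in\bigotimes'_v(\mathcal H_v,h_v)\simeq\mathcal H$. -/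

import Mathlib

section
open Filter Matrix
open scoped ComplexOrder InnerProductSpace

namespace RestrictedTensor

/-! ### Hilbert space with prescribed inner products -/

/-- The sesquilinear form with matrix `K` on finitely supported functions. -/
noncomputable def kernelForm {S : Type*} (K : Matrix S S ℂ) (f g : S →₀ ℂ) : ℂ :=
  f.sum fun s c => g.sum fun t d => star c * K s t * d

/-- The vector space with basis `S`, carrying the positive semidefinite form `kernelForm K`. -/
@[nolint unusedArguments]
def PreKernelSpace {S : Type*} (K : Matrix S S ℂ) (_hK : K.PosSemidef) : Type _ := S →₀ ℂ

theorem kernelForm_add_left {S : Type*} (K : Matrix S S ℂ) (f g h : S →₀ ℂ) :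
    kernelForm K (f + g) h = kernelForm K f h + kernelForm K g h := by
  unfold kernelForm
  rw [Finsupp.sum_add_index']
  · simp
  · intro s c d
    simp [add_mul, ← Finsupp.sum_add]

theorem kernelForm_smul_left {S : Type*} (K : Matrix S S ℂ) (f g : S →₀ ℂ) (r : ℂ) :
    kernelForm K (r • f) g = star r * kernelForm K f g := by
  unfold kernelForm
  rw [Finsupp.sum_smul_index']
  · simp [Finsupp.mul_sum, mul_assoc]
  · simp

theorem kernelForm_conj {S : Type*} {K : Matrix S S ℂ} (hK : K.IsHermitian) (f g : S →₀ ℂ) :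
    star (kernelForm K g f) = kernelForm K f g := by
  unfold kernelForm
  rw [Finsupp.sum_comm]
  simp only [RCLike.star_def, map_finsuppSum]
  refine Finset.sum_congr rfl fun s _ => Finset.sum_congr rfl fun t _ => ?_
  simp only [map_mul, RingHomCompTriple.comp_apply, RingHom.id_apply]
  rw [← hK.apply s t, RCLike.star_def]
  ring

theorem kernelForm_gram {S : Type*} {E : Type*} [NormedAddCommGroup E] [InnerProductSpace ℂ E]
    (g : S → E) (f : S →₀ ℂ) :
    kernelForm (Matrix.gram ℂ g) f f
      = ⟪Finsupp.linearCombination ℂ g f, Finsupp.linearCombination ℂ g f⟫_ℂ := by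
  unfold kernelForm
  simp only [Finsupp.linearCombination_apply, Finsupp.sum, Matrix.gram_apply, RCLike.star_def]
  rw [sum_inner]
  refine Finset.sum_congr rfl fun s _ => ?_
  rw [inner_sum]
  refine Finset.sum_congr rfl fun t _ => ?_
  rw [inner_smul_left, inner_smul_right]
  ring

theorem kernelForm_smul_sub {S : Type*} (K L : Matrix S S ℂ) (r : ℝ) (f : S →₀ ℂ) :
    kernelForm (r • K - L) f f = r * kernelForm K f f - kernelForm L f f := by
  unfold kernelForm
  simp only [Finsupp.sum, Matrix.sub_apply, Matrix.smul_apply, mul_sub, sub_mul,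
    Finset.sum_sub_distrib, Finset.mul_sum, Complex.real_smul]
  congr 1
  refine Finset.sum_congr rfl fun s _ => Finset.sum_congr rfl fun t _ => ?_
  ring

theorem norm_linearCombination_sq_le {S : Type*} {K : Matrix S S ℂ} {E : Type*}
    [NormedAddCommGroup E] [InnerProductSpace ℂ E] (g : S → E) (C : ℝ)
    (h : ((C ^ 2 : ℝ) • K - Matrix.gram ℂ g).PosSemidef) (f : S →₀ ℂ) :
    ‖Finsupp.linearCombination ℂ g f‖ ^ 2 ≤ C ^ 2 * RCLike.re (kernelForm K f f) := by
  have h1 : 0 ≤ RCLike.re (kernelForm ((C ^ 2 : ℝ) • K - Matrix.gram ℂ g) f f) :=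
    (RCLike.nonneg_iff.mp (h.2 f)).1
  rw [kernelForm_smul_sub, kernelForm_gram, map_sub, inner_self_eq_norm_sq] at h1
  have h2 := RCLike.re_ofReal_mul (K := ℂ) (C ^ 2) (kernelForm K f f)
  rw [← h2]
  exact sub_nonneg.mp h1

section KernelSpace

variable {S : Type*} (K : Matrix S S ℂ) (hK : K.PosSemidef)

noncomputable instance : AddCommGroup (PreKernelSpace K hK) :=
  inferInstanceAs (AddCommGroup (S →₀ ℂ))

noncomputable instance : Module ℂ (PreKernelSpace K hK) :=
  inferInstanceAs (Module ℂ (S →₀ ℂ))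

noncomputable instance preKernelCore : PreInnerProductSpace.Core ℂ (PreKernelSpace K hK) where
  inner f g := kernelForm K f g
  conj_inner_symm f g := kernelForm_conj hK.isHermitian f g
  add_left f g h := kernelForm_add_left K f g h
  smul_left f g r := kernelForm_smul_left K f g r
  re_inner_nonneg f := (RCLike.nonneg_iff.mp (hK.2 f)).1

noncomputable instance : SeminormedAddCommGroup (PreKernelSpace K hK) :=
  InnerProductSpace.Core.toSeminormedAddCommGroup (𝕜 := ℂ)

noncomputable instance : InnerProductSpace ℂ (PreKernelSpace K hK) := .ofCore _

/-- The Hilbert space generated by vectors `vec s`, `s : S`, with inner products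
`⟪vec s, vec t⟫ = K s t`: the completion of the vector space with basis `S` for the positive
semidefinite form given by `K` (vectors of length zero being divided out). -/
def KernelSpace : Type _ := UniformSpace.Completion (PreKernelSpace K hK)

noncomputable instance : NormedAddCommGroup (KernelSpace K hK) :=
  inferInstanceAs (NormedAddCommGroup (UniformSpace.Completion (PreKernelSpace K hK)))

noncomputable instance : InnerProductSpace ℂ (KernelSpace K hK) :=
  inferInstanceAs (InnerProductSpace ℂ (UniformSpace.Completion (PreKernelSpace K hK)))

instance : CompleteSpace (KernelSpace K hK) :=
  inferInstanceAs (CompleteSpace (UniformSpace.Completion (PreKernelSpace K hK)))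

/-- The generating vectors. -/
noncomputable def KernelSpace.vec (s : S) : KernelSpace K hK :=
  UniformSpace.Completion.toComplL (𝕜 := ℂ) (E := PreKernelSpace K hK) (Finsupp.single s (1 : ℂ))

theorem PreKernelSpace.eq_sum (f : PreKernelSpace K hK) :
    UniformSpace.Completion.toComplL (𝕜 := ℂ) (E := PreKernelSpace K hK) f
      = Finsupp.sum (α := S) f fun s c => c • KernelSpace.vec K hK s := by
  have h : f = Finsupp.sum (α := S) (M := ℂ) f
      fun s c => c • (Finsupp.single s (1 : ℂ) : S →₀ ℂ) := by
    simp only [Finsupp.smul_single_one]; exact (Finsupp.sum_single (α := S) f).symm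
  conv_lhs => rw [h]
  unfold Finsupp.sum
  refine (map_sum (UniformSpace.Completion.toComplL (𝕜 := ℂ) (E := PreKernelSpace K hK))
    _ _).trans ?_
  refine Finset.sum_congr rfl fun s _ => ?_
  exact map_smul (UniformSpace.Completion.toComplL (𝕜 := ℂ) (E := PreKernelSpace K hK)) _ _

theorem KernelSpace.inner_vec (s t : S) :
    ⟪KernelSpace.vec K hK s, KernelSpace.vec K hK t⟫_ℂ = K s t := by
  refine (UniformSpace.Completion.inner_coe (𝕜 := ℂ) (E := PreKernelSpace K hK) _ _).trans ?_
  change kernelForm K (Finsupp.single s (1 : ℂ)) (Finsupp.single t (1 : ℂ)) = _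
  simp [kernelForm]

theorem KernelSpace.dense_span :
    (Submodule.span ℂ (Set.range (KernelSpace.vec K hK))).topologicalClosure = ⊤ := by
  rw [Submodule.eq_top_iff']
  intro x
  refine closure_mono ?_ ((UniformSpace.Completion.denseRange_coe (α := PreKernelSpace K hK)) x)
  rintro _ ⟨f, rfl⟩
  have := PreKernelSpace.eq_sum K hK f
  change UniformSpace.Completion.toComplL (𝕜 := ℂ) (E := PreKernelSpace K hK) f ∈ _
  rw [this]
  exact Submodule.sum_mem _ fun s _ => Submodule.smul_mem _ _ (Submodule.subset_span ⟨s, rfl⟩)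

variable {K hK}

/-- Continuous linear maps out of the space are determined by the generating vectors. -/
theorem KernelSpace.ext_clm {E : Type*} [NormedAddCommGroup E] [NormedSpace ℂ E]
    {f g : KernelSpace K hK →L[ℂ] E}
    (h : ∀ s, f (KernelSpace.vec K hK s) = g (KernelSpace.vec K hK s)) : f = g := by
  refine ContinuousLinearMap.ext_on (s := Set.range (KernelSpace.vec K hK)) ?_ ?_
  · have := KernelSpace.dense_span K hK
    rwa [Submodule.dense_iff_topologicalClosure_eq_top]
  · rintro _ ⟨s, rfl⟩; exact h s

/-- A family of vectors whose Gram matrix is dominated by `C² K` defines a bounded operator. -/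
theorem KernelSpace.exists_lift {E : Type*} [NormedAddCommGroup E] [InnerProductSpace ℂ E]
    [CompleteSpace E] (g : S → E) (C : ℝ)
    (h : ((C ^ 2 : ℝ) • K - Matrix.gram ℂ g).PosSemidef) :
    ∃ T : KernelSpace K hK →L[ℂ] E, (∀ s, T (KernelSpace.vec K hK s) = g s) ∧ ‖T‖ ≤ |C| := by
  let f₀ : PreKernelSpace K hK →ₗ[ℂ] E := Finsupp.linearCombination ℂ g
  have hf : ∀ x, ‖f₀ x‖ ≤ |C| * ‖x‖ := by
    intro x
    rw [← sq_le_sq₀ (norm_nonneg _) (by positivity), mul_pow, sq_abs]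
    have h3 : ‖x‖ ^ 2 = RCLike.re (kernelForm K x x) := by
      rw [← inner_self_eq_norm_sq (𝕜 := ℂ)]; rfl
    rw [h3]
    exact norm_linearCombination_sq_le g C h x
  let f₁ : PreKernelSpace K hK →L[ℂ] E := f₀.mkContinuous |C| hf
  refine ⟨f₁.fromCompletion, fun s => ?_, ?_⟩
  · refine (ContinuousLinearMap.fromCompletion_apply_coe f₁ _).trans ?_
    change Finsupp.linearCombination ℂ g (Finsupp.single s 1) = g s
    simp
  · refine ContinuousLinearMap.opNorm_le_bound _ (abs_nonneg _) fun x => ?_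
    refine UniformSpace.Completion.induction_on (α := PreKernelSpace K hK)
      (p := fun x => ‖f₁.fromCompletion x‖ ≤ |C| * ‖x‖) x ?_ ?_
    · exact isClosed_le (by fun_prop) (by fun_prop)
    · intro x
      rw [ContinuousLinearMap.fromCompletion_apply_coe, UniformSpace.Completion.norm_coe]
      exact hf x

end KernelSpace
/-! ### Restricted tensor products of Hilbert spaces -/

theorem posSemidef_of_local {S : Type*} {M : Matrix S S ℂ}
    (h : ∀ t : Finset S, ∃ N : Matrix S S ℂ, N.PosSemidef ∧ ∀ a ∈ t, ∀ b ∈ t, M a b = N a b) :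
    M.PosSemidef := by
  classical
  refine ⟨?_, fun x => ?_⟩
  · ext a b
    obtain ⟨N, hN, hMN⟩ := h {a, b}
    rw [Matrix.conjTranspose_apply, hMN b (by simp) a (by simp), hMN a (by simp) b (by simp)]
    exact hN.isHermitian.apply a b
  · obtain ⟨N, hN, hMN⟩ := h x.support
    have := hN.2 x
    simp only [Finsupp.sum] at this ⊢
    convert this using 5 with a ha b hb
    exact hMN a ha b hb

theorem gram_posSemidef {S E : Type*} [NormedAddCommGroup E] [InnerProductSpace ℂ E] (g : S → E) :
    (Matrix.gram ℂ g).PosSemidef := by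
  refine ⟨Matrix.isHermitian_gram ℂ g, fun f => ?_⟩
  have h := kernelForm_gram g f
  rw [inner_self_eq_norm_sq_to_K] at h
  change 0 ≤ kernelForm (Matrix.gram ℂ g) f f
  rw [h]
  rw [← RCLike.ofReal_pow]
  exact RCLike.ofReal_nonneg.mpr (sq_nonneg _)

theorem posSemidef_prod {I S : Type*} (F : Finset I) (M : I → Matrix S S ℂ)
    (hM : ∀ v, (M v).PosSemidef) :
    (Matrix.of fun a b => ∏ v ∈ F, M v a b : Matrix S S ℂ).PosSemidef := by
  classical
  induction F using Finset.induction_on with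
  | empty =>
    have : (Matrix.of fun a b => ∏ v ∈ (∅ : Finset I), M v a b : Matrix S S ℂ)
        = Matrix.gram ℂ fun _ : S => (1 : ℂ) := by
      ext a b; simp
    rw [this]; exact gram_posSemidef _
  | insert a F ha ih =>
    have : (Matrix.of fun s t => ∏ v ∈ insert a F, M v s t : Matrix S S ℂ)
        = Matrix.hadamard (M a) (Matrix.of fun s t => ∏ v ∈ F, M v s t) := by
      ext s t; simp [Finset.prod_insert ha]
    rw [this]; exact (hM a).hadamard ih

theorem posSemidef_prod_sub_prod {I S : Type*} (F : Finset I) (M N : I → Matrix S S ℂ) (c : I → ℝ)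
    (hc : ∀ v, 0 ≤ c v) (hM : ∀ v, (M v).PosSemidef) (hN : ∀ v, (N v).PosSemidef)
    (h : ∀ v, (c v • M v - N v).PosSemidef) :
    ((∏ v ∈ F, c v) • (Matrix.of fun a b => ∏ v ∈ F, M v a b : Matrix S S ℂ)
      - (Matrix.of fun a b => ∏ v ∈ F, N v a b : Matrix S S ℂ)).PosSemidef := by
  classical
  induction F using Finset.induction_on with
  | empty => simpa using Matrix.PosSemidef.zero
  | insert a F ha ih =>
    have : ((∏ v ∈ insert a F, c v) • (Matrix.of fun s t => ∏ v ∈ insert a F, M v s t)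
          - (Matrix.of fun s t => ∏ v ∈ insert a F, N v s t) : Matrix S S ℂ)
        = Matrix.hadamard (c a • M a - N a)
            ((∏ v ∈ F, c v) • (Matrix.of fun s t => ∏ v ∈ F, M v s t))
          + Matrix.hadamard (N a) ((∏ v ∈ F, c v) • (Matrix.of fun s t => ∏ v ∈ F, M v s t)
            - (Matrix.of fun s t => ∏ v ∈ F, N v s t)) := by
      ext s t
      simp [Finset.prod_insert ha]
      ring
    rw [this]
    exact ((h a).hadamard ((posSemidef_prod F M hM).smul
      (Finset.prod_nonneg fun v _ => hc v))).add ((hN a).hadamard ih)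

/-- The families that agree with the family `h` of distinguished elements at all but finitely many
indices. -/
structure Family {I : Type*} {W : I → Type*} (h : ∀ v, W v) where
  /-- The family. -/
  toFun : ∀ v, W v
  /-- It agrees with `h` at all but finitely many indices. -/
  eventually_eq : ∀ᶠ v in cofinite, toFun v = h v

section Hilbert

variable {I : Type*} {H H' H'' : I → Type*}
  [∀ v, NormedAddCommGroup (H v)] [∀ v, InnerProductSpace ℂ (H v)]
  [∀ v, NormedAddCommGroup (H' v)] [∀ v, InnerProductSpace ℂ (H' v)]
  [∀ v, NormedAddCommGroup (H'' v)] [∀ v, InnerProductSpace ℂ (H'' v)]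

open Classical in
/-- The inner products `⟪⊗ e v, ⊗ f v⟫ = ∏ ⟪e v, f v⟫` of simple tensors. The distinguished vectors
are meant to be unit vectors at all but finitely many indices, so that all but finitely many factors
are `1`; otherwise the restricted tensor product is zero by convention. -/
noncomputable def restrictedKernel (h : ∀ v, H v) : Matrix (Family h) (Family h) ℂ :=
  fun e f => if ∀ᶠ v in cofinite, ‖h v‖ = 1 then ∏ᶠ v, ⟪e.1 v, f.1 v⟫_ℂ else 0

theorem finite_exceptional {W : I → Type*} {h : ∀ v, W v} (t : Finset (Family h)) :
    {v | ∃ e ∈ t, e.1 v ≠ h v}.Finite := by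
  have : {v | ∃ e ∈ t, e.1 v ≠ h v} = ⋃ e ∈ t, {v | e.1 v ≠ h v} := by
    ext v; simp
  rw [this]
  exact t.finite_toSet.biUnion fun e _ => e.2

theorem restrictedKernel_eq_prod {h : ∀ v, H v} (hh : ∀ᶠ v in cofinite, ‖h v‖ = 1)
    (e f : Family h) (F : Finset I) (hF : ∀ v ∉ F, e.1 v = h v ∧ f.1 v = h v ∧ ‖h v‖ = 1) :
    restrictedKernel h e f = ∏ v ∈ F, ⟪e.1 v, f.1 v⟫_ℂ := by
  rw [restrictedKernel, if_pos hh]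
  refine finprod_eq_prod_of_mulSupport_subset _ fun v hv => ?_
  by_contra hvF
  obtain ⟨h1, h2, h3⟩ := hF v hvF
  refine hv ?_
  change ⟪e.1 v, f.1 v⟫_ℂ = 1
  rw [h1, h2, inner_self_eq_norm_sq_to_K, h3]
  simp

theorem restrictedKernel_posSemidef (h : ∀ v, H v) : (restrictedKernel h).PosSemidef := by
  by_cases hh : ∀ᶠ v in cofinite, ‖h v‖ = 1
  · refine posSemidef_of_local fun t => ?_
    have hfin : ({v | ∃ e ∈ t, e.1 v ≠ h v} ∪ {v | ¬ ‖h v‖ = 1}).Finite :=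
      (finite_exceptional t).union hh
    refine ⟨_, posSemidef_prod hfin.toFinset
      (fun v => Matrix.gram ℂ fun e : Family h => e.1 v) (fun v => gram_posSemidef _), ?_⟩
    intro a ha b hb
    refine restrictedKernel_eq_prod hh a b _ fun v hv => ?_
    simp only [Set.Finite.mem_toFinset, Set.mem_union, Set.mem_ofPred_eq, not_or, not_exists,
      not_and, not_not] at hv
    exact ⟨hv.1 a ha, hv.1 b hb, hv.2⟩
  · have : restrictedKernel h = 0 := by
      ext e f; simp [restrictedKernel, hh]
    rw [this]; exact Matrix.PosSemidef.zero

/-- The restricted tensor product `⊗' (H v, h v)` of Hilbert spaces: the completion of the span of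
the simple tensors `⊗ e v`, where `e v = h v` for all but finitely many `v`, for the inner product
with `⟪⊗ e v, ⊗ f v⟫ = ∏ ⟪e v, f v⟫`. -/
def HilbertTensor (h : ∀ v, H v) : Type _ :=
  KernelSpace (restrictedKernel h) (restrictedKernel_posSemidef h)

noncomputable instance (h : ∀ v, H v) : NormedAddCommGroup (HilbertTensor h) :=
  inferInstanceAs (NormedAddCommGroup (KernelSpace _ _))

noncomputable instance (h : ∀ v, H v) : InnerProductSpace ℂ (HilbertTensor h) :=
  inferInstanceAs (InnerProductSpace ℂ (KernelSpace _ _))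

instance (h : ∀ v, H v) : CompleteSpace (HilbertTensor h) :=
  inferInstanceAs (CompleteSpace (KernelSpace _ _))

/-- The simple tensors, as generating vectors. -/
noncomputable def HilbertTensor.vec {h : ∀ v, H v} (e : Family h) : HilbertTensor h :=
  KernelSpace.vec _ _ e

theorem HilbertTensor.inner_vec {h : ∀ v, H v} (e f : Family h) :
    ⟪HilbertTensor.vec e, HilbertTensor.vec f⟫_ℂ = restrictedKernel h e f :=
  KernelSpace.inner_vec _ _ _ _

open Classical in
/-- The simple tensor `⊗ e v` in `⊗' (H v, h v)`, for a family `e` with `e v = h v` for all but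
finitely many `v` (and zero, as a junk value, for all other families). -/
noncomputable def HilbertTensor.tprod (h e : ∀ v, H v) : HilbertTensor h :=
  if he : ∀ᶠ v in cofinite, e v = h v then HilbertTensor.vec ⟨e, he⟩ else 0

theorem HilbertTensor.tprod_family {h : ∀ v, H v} (e : Family h) :
    HilbertTensor.tprod h e.1 = HilbertTensor.vec e := by
  rw [HilbertTensor.tprod, dif_pos e.2]

theorem HilbertTensor.inner_tprod {h e f : ∀ v, H v} (hh : ∀ᶠ v in cofinite, ‖h v‖ = 1)
    (he : ∀ᶠ v in cofinite, e v = h v) (hf : ∀ᶠ v in cofinite, f v = h v) :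
    ⟪HilbertTensor.tprod h e, HilbertTensor.tprod h f⟫_ℂ = ∏ᶠ v, ⟪e v, f v⟫_ℂ := by
  rw [HilbertTensor.tprod_family ⟨e, he⟩, HilbertTensor.tprod_family ⟨f, hf⟩]
  rw [HilbertTensor.inner_vec]
  rw [restrictedKernel, if_pos hh]

theorem HilbertTensor.tprod_eq_zero {h e : ∀ v, H v} (hh : ¬ ∀ᶠ v in cofinite, ‖h v‖ = 1) :
    HilbertTensor.tprod h e = 0 := by
  by_cases he : ∀ᶠ v in cofinite, e v = h v
  · rw [← inner_self_eq_zero (𝕜 := ℂ), HilbertTensor.tprod_family ⟨e, he⟩]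
    rw [HilbertTensor.inner_vec]
    rw [restrictedKernel, if_neg hh]
  · rw [HilbertTensor.tprod, dif_neg he]

theorem HilbertTensor.ext_clm {h : ∀ v, H v} {E : Type*} [NormedAddCommGroup E] [NormedSpace ℂ E]
    {f g : HilbertTensor h →L[ℂ] E}
    (hfg : ∀ e : ∀ v, H v, (∀ᶠ v in cofinite, e v = h v) →
      f (HilbertTensor.tprod h e) = g (HilbertTensor.tprod h e)) : f = g := by
  refine KernelSpace.ext_clm fun s => ?_
  have := hfg s.1 s.2
  rw [HilbertTensor.tprod_family] at this
  exact this

theorem HilbertTensor.exists_map {h : ∀ v, H v} {h' : ∀ v, H' v} (B : ∀ v, H v →L[ℂ] H' v)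
    (hB : ∀ᶠ v in cofinite, B v (h v) = h' v ∧ ‖B v‖ ≤ 1) (hh : ∀ᶠ v in cofinite, ‖h v‖ = 1) :
    ∃ T : HilbertTensor h →L[ℂ] HilbertTensor h', ∀ e : ∀ v, H v, (∀ᶠ v in cofinite, e v = h v) →
      T (HilbertTensor.tprod h e) = HilbertTensor.tprod h' fun v => B v (e v) := by
  classical
  have hc : {v | ¬ (B v (h v) = h' v ∧ ‖B v‖ ≤ 1)}.Finite := hB
  set F₀ : Finset I := hc.toFinset with hF₀
  set c : I → ℝ := fun v => if v ∈ F₀ then ‖B v‖ ^ 2 else 1 with hcdef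
  have hc0 : ∀ v, 0 ≤ c v := fun v => by
    simp only [hcdef]; split_ifs <;> positivity
  have hcB : ∀ v, ‖B v‖ ^ 2 ≤ c v := fun v => by
    simp only [hcdef]
    split_ifs with hv
    · exact le_rfl
    · have : ‖B v‖ ≤ 1 := by
        by_contra hne
        exact hv (by rw [hF₀, Set.Finite.mem_toFinset]; exact fun hx => hne hx.2)
      nlinarith [norm_nonneg (B v)]
  have hcF : ∀ F : Finset I, F₀ ⊆ F → ∏ v ∈ F, c v = ∏ v ∈ F₀, c v := fun F hF => by
    symm
    refine Finset.prod_subset hF fun v _ hv => ?_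
    simp [hcdef, hv]
  have hP : 0 ≤ ∏ v ∈ F₀, c v := Finset.prod_nonneg fun v _ => hc0 v
  have key : ((√(∏ v ∈ F₀, c v) ^ 2) • restrictedKernel h - Matrix.gram ℂ fun e : Family h =>
      HilbertTensor.tprod h' fun v => B v (e.1 v)).PosSemidef := by
    rw [Real.sq_sqrt hP]
    have hBe : ∀ e : Family h, ∀ᶠ v in cofinite, B v (e.1 v) = h' v := fun e => by
      filter_upwards [hB, e.2] with v h1 h2
      rw [h2, h1.1]
    by_cases hh' : ∀ᶠ v in cofinite, ‖h' v‖ = 1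
    · refine posSemidef_of_local fun t => ?_
      have hfin : ({v | ∃ e ∈ t, e.1 v ≠ h v} ∪ {v | ¬ ‖h v‖ = 1} ∪ {v | ¬ ‖h' v‖ = 1}).Finite :=
        ((finite_exceptional t).union hh).union hh'
      set F : Finset I := hfin.toFinset ∪ F₀ with hF
      have hmem : ∀ v ∉ F, (∀ e ∈ t, e.1 v = h v) ∧ ‖h v‖ = 1 ∧ ‖h' v‖ = 1 ∧ B v (h v) = h' v := by
        intro v hv
        simp only [hF, hF₀, Finset.mem_union, Set.Finite.mem_toFinset, Set.mem_union,
          Set.mem_ofPred_eq, not_or, not_exists, not_and, not_not] at hv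
        refine ⟨hv.1.1.1, hv.1.1.2, hv.1.2, ?_⟩
        by_contra hne
        exact hv.2 fun hx => absurd hx hne
      refine ⟨_, posSemidef_prod_sub_prod F (fun v => Matrix.gram ℂ fun e : Family h => e.1 v)
        (fun v => Matrix.gram ℂ fun e : Family h => B v (e.1 v)) c hc0
        (fun v => gram_posSemidef _) (fun v => gram_posSemidef _) ?_, ?_⟩
      · intro v
        have h1 := Matrix.posSemidef_opNorm_smul_gram_sub_gram (𝕜 := ℂ)
          (fun e : Family h => e.1 v) (B v)
        have h2 := (gram_posSemidef (fun e : Family h => e.1 v)).smul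
          (sub_nonneg.mpr (hcB v))
        have h3 := h2.add h1
        convert h3 using 1
        rw [sub_smul]
        simp only [Function.comp_def]
        abel
      · intro a ha b hb
        rw [hcF F Finset.subset_union_right]
        simp only [Matrix.sub_apply, Matrix.smul_apply, Matrix.gram_apply, Matrix.of_apply]
        congr 1
        · congr 1
          exact restrictedKernel_eq_prod hh a b F fun v hv =>
            ⟨(hmem v hv).1 a ha, (hmem v hv).1 b hb, (hmem v hv).2.1⟩
        · rw [HilbertTensor.tprod_family ⟨_, hBe a⟩, HilbertTensor.tprod_family ⟨_, hBe b⟩]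
          rw [HilbertTensor.inner_vec]
          refine restrictedKernel_eq_prod hh' _ _ F fun v hv => ?_
          obtain ⟨h1, h2, h3, h4⟩ := hmem v hv
          exact ⟨by simp only [h1 a ha, h4], by simp only [h1 b hb, h4], h3⟩
    · have : (Matrix.gram ℂ fun e : Family h =>
          HilbertTensor.tprod h' fun v => B v (e.1 v)) = 0 := by
        ext a b
        rw [Matrix.gram_apply, HilbertTensor.tprod_eq_zero hh', inner_zero_left]; rfl
      rw [this, sub_zero]
      exact (restrictedKernel_posSemidef h).smul hP
  obtain ⟨T, hT, -⟩ := KernelSpace.exists_lift (hK := restrictedKernel_posSemidef h)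
    (fun e : Family h => HilbertTensor.tprod h' fun v => B v (e.1 v)) _ key
  refine ⟨T, fun e he => ?_⟩
  rw [HilbertTensor.tprod_family ⟨e, he⟩]
  exact hT _

open Classical in
/-- The bounded operator `⊗' B v` from `⊗' (H v, h v)` to `⊗' (H' v, h' v)` with
`⊗ e v ↦ ⊗ B v (e v)`, where `B v (h v) = h' v` and `‖B v‖ ≤ 1` for all but finitely many `v`
(and zero, as a junk value, if there is no such operator). -/
noncomputable def HilbertTensor.map (h : ∀ v, H v) (h' : ∀ v, H' v) (B : ∀ v, H v →L[ℂ] H' v) :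
    HilbertTensor h →L[ℂ] HilbertTensor h' :=
  if hT : ∃ T : HilbertTensor h →L[ℂ] HilbertTensor h', ∀ e : ∀ v, H v,
      (∀ᶠ v in cofinite, e v = h v) →
        T (HilbertTensor.tprod h e) = HilbertTensor.tprod h' fun v => B v (e v)
  then hT.choose else 0

theorem HilbertTensor.map_tprod {h : ∀ v, H v} {h' : ∀ v, H' v} {B : ∀ v, H v →L[ℂ] H' v}
    (hB : ∀ᶠ v in cofinite, B v (h v) = h' v ∧ ‖B v‖ ≤ 1) (hh : ∀ᶠ v in cofinite, ‖h v‖ = 1)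
    {e : ∀ v, H v} (he : ∀ᶠ v in cofinite, e v = h v) :
    HilbertTensor.map h h' B (HilbertTensor.tprod h e)
      = HilbertTensor.tprod h' fun v => B v (e v) := by
  have hT := HilbertTensor.exists_map B hB hh
  rw [HilbertTensor.map, dif_pos hT]
  exact hT.choose_spec e he

end Hilbert
/-! ### Right Hilbert modules and interior tensor products with representations

A right Hilbert `A`-module is a `CStarModule` over the opposite algebra `Aᵐᵒᵖ`; the element `x a` is
`MulOpposite.op a • x`. -/

/-- The `A`-valued inner product `⟨x, y⟩` of a right Hilbert `A`-module, with
`⟨x, y a⟩ = ⟨x, y⟩ a`. -/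
def rinner (A : Type*) {X : Type*} [Inner Aᵐᵒᵖ X] (x y : X) : A := (inner Aᵐᵒᵖ x y).unop

theorem exists_negPart_data {M : Type*} [NonUnitalCStarAlgebra M] [PartialOrder M]
    [StarOrderedRing M] (G : M) (hG : IsSelfAdjoint G) :
    ∃ N s : M, star N = N ∧ star s = s ∧ N = s * s ∧ N * G = -(N * N) ∧
      (N = 0 → ∃ B : M, G = star B * B) := by
  obtain ⟨s, hs, hss⟩ := CStarAlgebra.nonneg_iff_exists_isSelfAdjoint_and_eq_mul_self.mp
    (CFC.negPart_nonneg G)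
  refine ⟨G⁻, s, (IsSelfAdjoint.of_nonneg (CFC.negPart_nonneg G)).star_eq, hs, hss, ?_, fun h => ?_⟩
  · have h2 : G = G⁺ - G⁻ := (CFC.posPart_sub_negPart G hG).symm
    calc G⁻ * G = G⁻ * (G⁺ - G⁻) := by rw [← h2]
      _ = -(G⁻ * G⁻) := by rw [mul_sub, CFC.negPart_mul_posPart, zero_sub]
  · rw [← CStarAlgebra.nonneg_iff_eq_star_mul_self,
      CStarAlgebra.nonneg_iff_isSelfAdjoint_and_negPart_eq_zero]
    exact ⟨hG, h⟩

section Matrices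

variable {A n : Type*} [NonUnitalCStarAlgebra A] [PartialOrder A] [StarOrderedRing A] [Fintype n]

theorem exists_eq_star_mul_self_of_forall_nonneg (G : CStarMatrix n n A) (hG : IsSelfAdjoint G)
    (h : ∀ a : n → A, 0 ≤ ∑ i, ∑ j, star (a i) * G i j * a j) :
    ∃ B : CStarMatrix n n A, G = star B * B := by
  classical
  obtain ⟨N, s, hNs, hs', hss, hNG, hres⟩ := exists_negPart_data G hG
  refine hres ?_
  have h1 : N * G * N = -(star (s * s * s) * (s * s * s)) := by
    rw [hNG, neg_mul]
    simp only [star_mul, hs']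
    rw [hss]
    simp only [mul_assoc]
  have h4 : ∀ k, (N * G * N) k k = ∑ i, ∑ j, star (N i k) * G i j * N j k := by
    intro k
    have : ∀ i, star (N i k) = N k i := fun i => by
      rw [← CStarMatrix.star_apply, hNs]
    simp only [CStarMatrix.mul_apply, this, Finset.sum_mul]
    exact Finset.sum_comm
  set t := s * s * s with ht
  have h5 : ∀ k, ∑ j, star (t j k) * t j k = 0 := by
    intro k
    have h6 : (star t * t) k k = ∑ j, star (t j k) * t j k := by
      simp only [CStarMatrix.mul_apply, CStarMatrix.star_apply]
    have h7 := h fun i => N i k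
    rw [← h4, h1, CStarMatrix.neg_apply, h6] at h7
    exact le_antisymm (neg_nonneg.mp h7) (Finset.sum_nonneg fun j _ => star_mul_self_nonneg _)
  have ht0 : t = 0 := by
    ext j k
    have := (Finset.sum_eq_zero_iff_of_nonneg (fun j _ => star_mul_self_nonneg (t j k))).mp (h5 k)
      j (Finset.mem_univ j)
    exact (CStarRing.star_mul_self_eq_zero_iff _).mp this
  have h8 : star (s * s) * (s * s) = 0 := by
    simp only [star_mul, hs']
    rw [← mul_assoc, ← ht, ht0, zero_mul]
  rw [hss]
  exact (CStarRing.star_mul_self_eq_zero_iff _).mp h8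

end Matrices

section Interior

set_option linter.unusedSectionVars false

variable {A X H : Type*} [NonUnitalCStarAlgebra A] [PartialOrder A] [StarOrderedRing A]
  [NormedAddCommGroup X] [NormedSpace ℂ X] [SMul Aᵐᵒᵖ X] [CStarModule Aᵐᵒᵖ X]
  [NormedAddCommGroup H] [InnerProductSpace ℂ H] [CompleteSpace H]

theorem rinner_smul_right (x y : X) (a : A) :
    rinner A x (MulOpposite.op a • y) = rinner A x y * a := by
  simp [rinner]

theorem rinner_smul_left (x y : X) (a : A) :
    rinner A (MulOpposite.op a • x) y = star a * rinner A x y := by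
  simp [rinner]

theorem star_rinner (x y : X) : star (rinner A x y) = rinner A y x := by
  rw [rinner, ← MulOpposite.unop_star, CStarModule.star_inner]; rfl

theorem rinner_self_nonneg (x : X) : 0 ≤ rinner A x x :=
  CStarModule.inner_self_nonneg (A := Aᵐᵒᵖ) (x := x)

theorem norm_rinner_self (x : X) : ‖rinner A x x‖ = ‖x‖ ^ 2 := by
  rw [CStarModule.norm_sq_eq (A := Aᵐᵒᵖ)]; rfl

theorem rinner_sum_sum {n : Type*} [Fintype n] (x : n → X) (a : n → A) :
    rinner A (∑ i, MulOpposite.op (a i) • x i) (∑ j, MulOpposite.op (a j) • x j)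
      = ∑ i, ∑ j, star (a i) * rinner A (x i) (x j) * a j := by
  rw [rinner, CStarModule.inner_sum_left, Finset.unop_sum]
  refine Finset.sum_congr rfl fun i _ => ?_
  rw [CStarModule.inner_sum_right, Finset.unop_sum]
  refine Finset.sum_congr rfl fun j _ => ?_
  exact (rinner_smul_right _ _ _).trans (by rw [rinner_smul_left])

/-- The inner products `⟪x ⊗ h, y ⊗ k⟫ = ⟪h, π(⟨x, y⟩) k⟫`. -/
noncomputable def interiorKernel (π : A →⋆ₙₐ[ℂ] (H →L[ℂ] H)) (X : Type*) [Inner Aᵐᵒᵖ X] :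
    Matrix (X × H) (X × H) ℂ :=
  fun s t => ⟪s.2, π (rinner A s.1 t.1) t.2⟫_ℂ

theorem interiorKernel_posSemidef (π : A →⋆ₙₐ[ℂ] (H →L[ℂ] H)) :
    (interiorKernel π X).PosSemidef := by
  classical
  have hstar : ∀ a h k, ⟪π a h, k⟫_ℂ = ⟪h, π (star a) k⟫_ℂ := fun a h k => by
    rw [map_star, ContinuousLinearMap.star_eq_adjoint, ContinuousLinearMap.adjoint_inner_right]
  refine ⟨?_, fun f => ?_⟩
  · ext s t
    rw [Matrix.conjTranspose_apply]
    simp only [interiorKernel, RCLike.star_def, inner_conj_symm]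
    rw [hstar, star_rinner]
  · let G : CStarMatrix f.support f.support A :=
      CStarMatrix.ofMatrix (Matrix.of fun i j => rinner A i.1.1 j.1.1)
    have hG : IsSelfAdjoint G := by
      ext i j
      rw [CStarMatrix.star_apply]
      exact star_rinner _ _
    obtain ⟨B, hB⟩ := exists_eq_star_mul_self_of_forall_nonneg G hG fun a => by
      have := rinner_self_nonneg (A := A)
        (∑ i : f.support, MulOpposite.op (a i) • (i.1.1 : X))
      rw [rinner_sum_sum] at this
      exact this
    have hG' : ∀ i j : f.support, rinner A i.1.1 j.1.1 = ∑ k, star (B k i) * B k j := by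
      intro i j
      have : G i j = (star B * B) i j := by rw [← hB]
      rw [CStarMatrix.mul_apply] at this
      simp only [CStarMatrix.star_apply] at this
      exact this
    have key : (f.sum fun i xi => f.sum fun j xj => star xi * interiorKernel π X i j * xj)
        = ∑ k : f.support, ⟪∑ i : f.support, π (B k i) (f i.1 • i.1.2),
            ∑ i : f.support, π (B k i) (f i.1 • i.1.2)⟫_ℂ := by
      simp only [Finsupp.sum]
      rw [← Finset.sum_coe_sort f.support]
      simp_rw [← Finset.sum_coe_sort f.support]
      simp only [sum_inner, inner_sum]
      rw [Finset.sum_comm]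
      conv_rhs => rw [Finset.sum_comm]
      refine Finset.sum_congr rfl fun j _ => ?_
      conv_rhs => rw [Finset.sum_comm]
      refine Finset.sum_congr rfl fun i _ => ?_
      simp only [interiorKernel]
      rw [hG', map_sum, _root_.sum_apply, inner_sum, Finset.mul_sum, Finset.sum_mul]
      refine Finset.sum_congr rfl fun k _ => ?_
      rw [hstar, map_mul, mul_apply_eq_comp, map_smul, map_smul, inner_smul_left,
        inner_smul_right, RCLike.star_def]
      ring
    rw [key]
    refine Finset.sum_nonneg fun k _ => ?_
    rw [inner_self_eq_norm_sq_to_K, ← RCLike.ofReal_pow]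
    exact RCLike.ofReal_nonneg.mpr (sq_nonneg _)

variable (X) in
/-- The interior tensor product `X ⊗_A H` of a right Hilbert `A`-module `X` with a representation
`π` of `A` on a Hilbert space `H`: the completion of the span of the tensors `x ⊗ h` for the inner
product with `⟪x ⊗ h, y ⊗ k⟫ = ⟪h, π(⟨x, y⟩) k⟫`. -/
def InteriorTensor (π : A →⋆ₙₐ[ℂ] (H →L[ℂ] H)) : Type _ :=
  KernelSpace (interiorKernel π X) (interiorKernel_posSemidef π)

noncomputable instance (π : A →⋆ₙₐ[ℂ] (H →L[ℂ] H)) : NormedAddCommGroup (InteriorTensor X π) :=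
  inferInstanceAs (NormedAddCommGroup (KernelSpace _ _))

noncomputable instance (π : A →⋆ₙₐ[ℂ] (H →L[ℂ] H)) : InnerProductSpace ℂ (InteriorTensor X π) :=
  inferInstanceAs (InnerProductSpace ℂ (KernelSpace _ _))

instance (π : A →⋆ₙₐ[ℂ] (H →L[ℂ] H)) : CompleteSpace (InteriorTensor X π) :=
  inferInstanceAs (CompleteSpace (KernelSpace _ _))

/-- The tensor `x ⊗ h` in `X ⊗_A H`. -/
noncomputable def InteriorTensor.tmul (π : A →⋆ₙₐ[ℂ] (H →L[ℂ] H)) (x : X) (h : H) :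
    InteriorTensor X π :=
  KernelSpace.vec _ _ (x, h)

theorem InteriorTensor.inner_tmul (π : A →⋆ₙₐ[ℂ] (H →L[ℂ] H)) (x y : X) (h k : H) :
    ⟪InteriorTensor.tmul π x h, InteriorTensor.tmul π y k⟫_ℂ = ⟪h, π (rinner A x y) k⟫_ℂ :=
  KernelSpace.inner_vec _ _ _ _

theorem InteriorTensor.ext_inner (π : A →⋆ₙₐ[ℂ] (H →L[ℂ] H)) {u w : InteriorTensor X π}
    (huw : ∀ (y : X) (k : H), ⟪InteriorTensor.tmul π y k, u⟫_ℂ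
      = ⟪InteriorTensor.tmul π y k, w⟫_ℂ) : u = w := by
  have : innerSL ℂ u = innerSL ℂ w := KernelSpace.ext_clm fun s => by
    have := congrArg (starRingEnd ℂ) (huw s.1 s.2)
    rwa [inner_conj_symm, inner_conj_symm] at this
  exact (innerSL_inj).mp this

/-- Tensoring with `x`, as an operator from `H` to `X ⊗_A H`. -/
noncomputable def InteriorTensor.creation (π : A →⋆ₙₐ[ℂ] (H →L[ℂ] H)) (x : X) :
    H →L[ℂ] InteriorTensor X π :=
  LinearMap.mkContinuous
    { toFun := fun h => InteriorTensor.tmul π x h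
      map_add' := fun h k => InteriorTensor.ext_inner π fun y l => by
        simp only [inner_add_right, InteriorTensor.inner_tmul, map_add]
      map_smul' := fun c h => InteriorTensor.ext_inner π fun y l => by
        simp only [inner_smul_right, InteriorTensor.inner_tmul, map_smul, RingHom.id_apply] }
    ‖x‖ fun h => by
      change ‖InteriorTensor.tmul π x h‖ ≤ ‖x‖ * ‖h‖
      rw [← sq_le_sq₀ (norm_nonneg _) (by positivity), ← inner_self_eq_norm_sq (𝕜 := ℂ),
        InteriorTensor.inner_tmul]
      calc RCLike.re ⟪h, π (rinner A x x) h⟫_ℂ ≤ ‖h‖ * ‖π (rinner A x x) h‖ :=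
            re_inner_le_norm _ _
        _ ≤ ‖h‖ * (‖rinner A x x‖ * ‖h‖) := by
            gcongr
            exact (ContinuousLinearMap.le_opNorm _ _).trans
              (by gcongr; exact NonUnitalStarAlgHom.norm_apply_le π _)
        _ = (‖x‖ * ‖h‖) ^ 2 := by rw [norm_rinner_self]; ring

theorem InteriorTensor.creation_apply (π : A →⋆ₙₐ[ℂ] (H →L[ℂ] H)) (x : X) (h : H) :
    InteriorTensor.creation π x h = InteriorTensor.tmul π x h := rfl

theorem InteriorTensor.norm_creation_le (π : A →⋆ₙₐ[ℂ] (H →L[ℂ] H)) (x : X) :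
    ‖InteriorTensor.creation π x‖ ≤ ‖x‖ :=
  LinearMap.mkContinuous_norm_le _ (norm_nonneg _) _

theorem InteriorTensor.tmul_smul (π : A →⋆ₙₐ[ℂ] (H →L[ℂ] H)) (x : X) (a : A) (h : H) :
    InteriorTensor.tmul π (MulOpposite.op a • x) h = InteriorTensor.tmul π x (π a h) :=
  InteriorTensor.ext_inner π fun y k => by
    simp only [InteriorTensor.inner_tmul, rinner_smul_right, map_mul, mul_apply_eq_comp]

end Interior
/-! ### The universal representation of a C⋆-algebra -/

section Universal

variable (A : Type*) [NonUnitalCStarAlgebra A] [PartialOrder A] [StarOrderedRing A]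

/-- The direct sum of the Hilbert spaces of all GNS representations of `A`. -/
abbrev UniversalSpace : Type _ := lp (fun φ : A →ₚ[ℂ] ℂ => φ.GNS) 2

variable {A}

theorem norm_gns_le (φ : A →ₚ[ℂ] ℂ) (a : A) : ‖φ.gnsNonUnitalStarAlgHom a‖ ≤ ‖a‖ :=
  NonUnitalStarAlgHom.norm_apply_le _ a

/-- The value of the universal representation at `a`, acting diagonally. -/
noncomputable def universalOp (a : A) : UniversalSpace A →L[ℂ] UniversalSpace A :=
  lp.mapCLM 2 (fun φ : A →ₚ[ℂ] ℂ => φ.gnsNonUnitalStarAlgHom a) (norm_nonneg a)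
    fun φ => norm_gns_le φ a

theorem universalOp_apply (a : A) (u : UniversalSpace A) (φ : A →ₚ[ℂ] ℂ) :
    universalOp a u φ = φ.gnsNonUnitalStarAlgHom a (u φ) := rfl

variable (A) in
/-- The universal representation of `A`: the direct sum of all GNS representations. -/
noncomputable def universalRep : A →⋆ₙₐ[ℂ] (UniversalSpace A →L[ℂ] UniversalSpace A) where
  toFun := universalOp
  map_smul' c a := by
    ext u φ : 3
    simp [universalOp_apply]
  map_zero' := by
    ext u φ : 3
    simp [universalOp_apply]
  map_add' a b := by
    ext u φ : 3
    simp [universalOp_apply]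
  map_mul' a b := by
    ext u φ : 3
    simp [universalOp_apply]
  map_star' a := by
    rw [ContinuousLinearMap.star_eq_adjoint, ContinuousLinearMap.eq_adjoint_iff]
    intro u w
    rw [lp.inner_eq_tsum, lp.inner_eq_tsum]
    refine tsum_congr fun φ => ?_
    rw [universalOp_apply, universalOp_apply, map_star, ContinuousLinearMap.star_eq_adjoint,
      ContinuousLinearMap.adjoint_inner_left]

theorem universalRep_single [DecidableEq (A →ₚ[ℂ] ℂ)] (a : A) (φ : A →ₚ[ℂ] ℂ) (u : φ.GNS) :
    universalRep A a (lp.single 2 φ u) = lp.single 2 φ (φ.gnsNonUnitalStarAlgHom a u) := by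
  ext ψ
  change ψ.gnsNonUnitalStarAlgHom a ((lp.single 2 φ u : UniversalSpace A) ψ) = _
  by_cases h : ψ = φ
  · subst h; simp
  · rw [lp.single_apply_ne _ _ _ h, lp.single_apply_ne _ _ _ h, map_zero]

/-- Positive functionals separate positive elements from zero. -/
theorem exists_positive_ne_zero {a : A} (ha : 0 ≤ a) (ha0 : a ≠ 0) :
    ∃ φ : A →ₚ[ℂ] ℂ, φ a ≠ 0 := by
  have hmem : -a ∉ ProperCone.positive ℝ A := by
    intro h
    have h' : 0 ≤ -a := h
    exact ha0 (le_antisymm (neg_nonneg.mp h') ha)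
  obtain ⟨f, hf, hfa⟩ := ProperCone.hyperplane_separation_point _ hmem
  have hpos : ∀ b : A, 0 ≤ b → 0 ≤ f b := fun b hb => hf b hb
  let φ₀ : A →ₗ[ℂ] ℂ :=
    { toFun := fun b => (f (realPart b) : ℂ) + (f (imaginaryPart b) : ℂ) * Complex.I
      map_add' := fun b c => by
        simp only [map_add, AddSubgroup.coe_add, Complex.ofReal_add]
        ring
      map_smul' := fun z b => by
        simp only [realPart_smul, imaginaryPart_smul, AddSubgroupClass.coe_sub,
          AddSubgroup.coe_add, selfAdjoint.val_smul, map_sub, map_add, map_smul, smul_eq_mul,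
          Complex.ofReal_sub, Complex.ofReal_add, Complex.ofReal_mul, RingHom.id_apply]
        conv_rhs => rw [← Complex.re_add_im z]
        linear_combination (-(z.im : ℂ)) * (f (imaginaryPart b) : ℂ) * Complex.I_mul_I }
  have hφ : ∀ b : A, IsSelfAdjoint b → φ₀ b = f b := fun b hb => by
    change (f (realPart b) : ℂ) + (f (imaginaryPart b) : ℂ) * Complex.I = f b
    rw [hb.coe_realPart, hb.imaginaryPart]
    simp
  refine ⟨PositiveLinearMap.mk₀ φ₀ fun b hb => ?_, ?_⟩
  · rw [hφ b (IsSelfAdjoint.of_nonneg hb)]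
    exact_mod_cast hpos b hb
  · change φ₀ a ≠ 0
    rw [hφ a (IsSelfAdjoint.of_nonneg ha)]
    rw [map_neg] at hfa
    exact_mod_cast (neg_neg_iff_pos.mp hfa).ne'

theorem universalRep_apply_star_ne_zero {a : A} (ha : a ≠ 0) :
    ∃ u : UniversalSpace A, universalRep A a u ≠ 0 := by
  classical
  have h0 : a * star a ≠ 0 := fun h => ha ((CStarRing.mul_star_self_eq_zero_iff a).mp h)
  have h1 : star (a * star a) * (a * star a) ≠ 0 := fun h =>
    h0 ((CStarRing.star_mul_self_eq_zero_iff _).mp h)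
  obtain ⟨φ, hφ⟩ := exists_positive_ne_zero (star_mul_self_nonneg (a * star a)) h1
  refine ⟨lp.single 2 φ ((φ.toPreGNS (star a) : φ.PreGNS) : φ.GNS), fun h => hφ ?_⟩
  rw [universalRep_single] at h
  have h2 := congrArg (fun w : UniversalSpace A => w φ) h
  simp only [lp.single_apply_self, PositiveLinearMap.gnsNonUnitalStarAlgHom_apply_coe,
    PositiveLinearMap.leftMulMapPreGNS_apply] at h2
  have h3 : ‖((φ.toPreGNS (a * star a) : φ.PreGNS) : φ.GNS)‖ = 0 := by
    rw [norm_eq_zero]; simpa using h2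
  rw [UniformSpace.Completion.norm_coe] at h3
  have h4 := φ.preGNS_norm_sq (φ.toPreGNS (a * star a))
  rw [h3] at h4
  simpa using h4.symm

/-- The universal representation is faithful. -/
theorem universalRep_injective : Function.Injective (universalRep A) := by
  rw [injective_iff_map_eq_zero]
  intro a ha
  by_contra h
  obtain ⟨u, hu⟩ := universalRep_apply_star_ne_zero h
  exact hu (by rw [ha]; rfl)

theorem exists_fixed_unit_vector {p : A} (hp : IsStarProjection p) (h0 : p ≠ 0) :
    ∃ k : UniversalSpace A, ‖k‖ = 1 ∧ universalRep A p k = k := by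
  obtain ⟨u, hu⟩ := universalRep_apply_star_ne_zero h0
  have hn : ‖universalRep A p u‖ ≠ 0 := norm_ne_zero_iff.mpr hu
  refine ⟨((‖universalRep A p u‖⁻¹ : ℝ) : ℂ) • universalRep A p u, ?_, ?_⟩
  · rw [norm_smul, Complex.norm_real, norm_inv, norm_norm, inv_mul_cancel₀ hn]
  · rw [map_smul, ← mul_apply_eq_comp, ← map_mul, hp.isIdempotentElem.eq]

end Universal
/-! ### Restricted tensor products of C⋆-algebras -/

section Algebra

set_option linter.unusedSectionVars false

variable {I : Type*} {A : I → Type*} [∀ v, NonUnitalCStarAlgebra (A v)] [∀ v, PartialOrder (A v)]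
  [∀ v, StarOrderedRing (A v)]

/-- A family of distinguished projections `p v ∈ A v`, nonzero for all but finitely many `v`. -/
structure ProjectionFamily {I : Type*} (A : I → Type*) [∀ v, NonUnitalCStarAlgebra (A v)] where
  /-- The projections. -/
  toFun : ∀ v, A v
  /-- They are projections. -/
  isStarProjection : ∀ v, IsStarProjection (toFun v)
  /-- All but finitely many of them are nonzero. -/
  eventually_ne_zero : ∀ᶠ v in cofinite, toFun v ≠ 0

variable (p : ProjectionFamily A)

open Classical in
/-- Unit vectors in the ranges of the projections `p v` in the universal representations of the
algebras `A v` (and zero where `p v = 0`). -/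
noncomputable def ProjectionFamily.unitVector (v : I) : UniversalSpace (A v) :=
  if hv : p.toFun v ≠ 0 then (exists_fixed_unit_vector (p.isStarProjection v) hv).choose else 0

theorem ProjectionFamily.eventually_unitVector :
    ∀ᶠ v in cofinite, ‖p.unitVector v‖ = 1 ∧
      universalRep (A v) (p.toFun v) (p.unitVector v) = p.unitVector v := by
  filter_upwards [p.eventually_ne_zero] with v hv
  rw [ProjectionFamily.unitVector, dif_pos hv]
  exact (exists_fixed_unit_vector (p.isStarProjection v) hv).choose_spec

theorem ProjectionFamily.eventually_norm : ∀ᶠ v in cofinite, ‖p.unitVector v‖ = 1 :=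
  p.eventually_unitVector.mono fun _ h => h.1

theorem ProjectionFamily.norm_le (v : I) : ‖p.toFun v‖ ≤ 1 := by
  have h := (p.isStarProjection v).isIdempotentElem
  have h2 := (p.isStarProjection v).isSelfAdjoint
  have h3 : ‖p.toFun v‖ * ‖p.toFun v‖ = ‖p.toFun v‖ := by
    rw [← CStarRing.norm_star_mul_self, h2.star_eq, h.eq]
  nlinarith [norm_nonneg (p.toFun v), sq_nonneg (‖p.toFun v‖ - 1)]

/-- The operator `⊗ σ v (a v)` on `⊗' (K v, k v)`, where `σ v` is the universal representation of
`A v` on `K v` and `k v` is a unit vector with `σ v (p v) (k v) = k v`. -/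
noncomputable def simpleOp (a : ∀ v, A v) :
    HilbertTensor p.unitVector →L[ℂ] HilbertTensor p.unitVector :=
  HilbertTensor.map p.unitVector p.unitVector fun v => universalRep (A v) (a v)

variable {p}

theorem eventually_rep {a : ∀ v, A v} (ha : ∀ᶠ v in cofinite, a v = p.toFun v) :
    ∀ᶠ v in cofinite, universalRep (A v) (a v) (p.unitVector v) = p.unitVector v ∧
      ‖universalRep (A v) (a v)‖ ≤ 1 := by
  filter_upwards [ha, p.eventually_unitVector] with v h1 h2
  rw [h1]
  exact ⟨h2.2, (NonUnitalStarAlgHom.norm_apply_le _ _).trans (p.norm_le v)⟩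

theorem simpleOp_tprod {a : ∀ v, A v} (ha : ∀ᶠ v in cofinite, a v = p.toFun v)
    {e : ∀ v, UniversalSpace (A v)} (he : ∀ᶠ v in cofinite, e v = p.unitVector v) :
    simpleOp p a (HilbertTensor.tprod _ e)
      = HilbertTensor.tprod _ fun v => universalRep (A v) (a v) (e v) :=
  HilbertTensor.map_tprod (eventually_rep ha) p.eventually_norm he

theorem eventually_rep_apply {a : ∀ v, A v} (ha : ∀ᶠ v in cofinite, a v = p.toFun v)
    {e : ∀ v, UniversalSpace (A v)} (he : ∀ᶠ v in cofinite, e v = p.unitVector v) :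
    ∀ᶠ v in cofinite, universalRep (A v) (a v) (e v) = p.unitVector v := by
  filter_upwards [eventually_rep ha, he] with v h1 h2
  rw [h2, h1.1]

theorem eventually_mul {a b : ∀ v, A v} (ha : ∀ᶠ v in cofinite, a v = p.toFun v)
    (hb : ∀ᶠ v in cofinite, b v = p.toFun v) : ∀ᶠ v in cofinite, a v * b v = p.toFun v := by
  filter_upwards [ha, hb] with v h1 h2
  rw [h1, h2, (p.isStarProjection v).isIdempotentElem.eq]

theorem eventually_star {a : ∀ v, A v} (ha : ∀ᶠ v in cofinite, a v = p.toFun v) :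
    ∀ᶠ v in cofinite, star (a v) = p.toFun v := by
  filter_upwards [ha] with v h1
  rw [h1, (p.isStarProjection v).isSelfAdjoint.star_eq]

theorem simpleOp_mul {a b : ∀ v, A v} (ha : ∀ᶠ v in cofinite, a v = p.toFun v)
    (hb : ∀ᶠ v in cofinite, b v = p.toFun v) :
    simpleOp p a * simpleOp p b = simpleOp p fun v => a v * b v := by
  refine HilbertTensor.ext_clm fun e he => ?_
  rw [mul_apply_eq_comp, simpleOp_tprod hb he, simpleOp_tprod ha (eventually_rep_apply hb he),
    simpleOp_tprod (eventually_mul ha hb) he]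
  simp only [map_mul, mul_apply_eq_comp]

theorem HilbertTensor.ext_inner {I : Type*} {H : I → Type*}
    [∀ v, NormedAddCommGroup (H v)] [∀ v, InnerProductSpace ℂ (H v)] {h : ∀ v, H v}
    {u w : HilbertTensor h}
    (huw : ∀ e : ∀ v, H v, (∀ᶠ v in cofinite, e v = h v) →
      ⟪HilbertTensor.tprod h e, u⟫_ℂ = ⟪HilbertTensor.tprod h e, w⟫_ℂ) : u = w := by
  have : innerSL ℂ u = innerSL ℂ w := HilbertTensor.ext_clm fun e he => by
    have := congrArg (starRingEnd ℂ) (huw e he)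
    rwa [inner_conj_symm, inner_conj_symm] at this
  exact (innerSL_inj).mp this

theorem star_simpleOp {a : ∀ v, A v} (ha : ∀ᶠ v in cofinite, a v = p.toFun v) :
    star (simpleOp p a) = simpleOp p fun v => star (a v) := by
  refine HilbertTensor.ext_clm fun e he => HilbertTensor.ext_inner fun f hf => ?_
  rw [ContinuousLinearMap.star_eq_adjoint, ContinuousLinearMap.adjoint_inner_right,
    simpleOp_tprod ha hf, simpleOp_tprod (eventually_star ha) he,
    HilbertTensor.inner_tprod p.eventually_norm (eventually_rep_apply ha hf) he,
    HilbertTensor.inner_tprod p.eventually_norm hf (eventually_rep_apply (eventually_star ha) he)]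
  refine finprod_congr fun v => ?_
  rw [map_star, ContinuousLinearMap.star_eq_adjoint, ContinuousLinearMap.adjoint_inner_right]

variable (p) in
/-- The span `A₀` of the simple tensors `⊗ a v` (where `a v = p v` for all but finitely many `v`),
realised faithfully as operators on `⊗' (K v, k v)`. -/
noncomputable def algebraicTensor :
    NonUnitalStarSubalgebra ℂ (HilbertTensor p.unitVector →L[ℂ] HilbertTensor p.unitVector) where
  carrier := Submodule.span ℂ
    {T | ∃ a : ∀ v, A v, (∀ᶠ v in cofinite, a v = p.toFun v) ∧ simpleOp p a = T}
  add_mem' := Submodule.add_mem _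
  zero_mem' := Submodule.zero_mem _
  smul_mem' c _ h := Submodule.smul_mem _ c h
  mul_mem' {S T} hS hT := by
    refine Submodule.span_induction₂ (p := fun S T _ _ => S * T ∈ Submodule.span ℂ _)
      ?_ ?_ ?_ ?_ ?_ ?_ ?_ hS hT
    · rintro _ _ ⟨a, ha, rfl⟩ ⟨b, hb, rfl⟩
      rw [simpleOp_mul ha hb]
      exact Submodule.subset_span ⟨_, eventually_mul ha hb, rfl⟩
    · intro S _; rw [zero_mul]; exact Submodule.zero_mem _
    · intro S _; rw [mul_zero]; exact Submodule.zero_mem _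
    · intro S S' T _ _ _ h h'; rw [add_mul]; exact Submodule.add_mem _ h h'
    · intro S T T' _ _ _ h h'; rw [mul_add]; exact Submodule.add_mem _ h h'
    · intro c S T _ _ h; rw [smul_mul_assoc]; exact Submodule.smul_mem _ c h
    · intro c S T _ _ h; rw [mul_smul_comm]; exact Submodule.smul_mem _ c h
  star_mem' {S} hS := by
    refine Submodule.span_induction (p := fun S _ => star S ∈ Submodule.span ℂ _) ?_ ?_ ?_ ?_ hS
    · rintro _ ⟨a, ha, rfl⟩
      rw [star_simpleOp ha]
      exact Submodule.subset_span ⟨_, eventually_star ha, rfl⟩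
    · rw [star_zero]; exact Submodule.zero_mem _
    · intro S S' _ _ h h'; rw [star_add]; exact Submodule.add_mem _ h h'
    · intro c S _ h; rw [star_smul]; exact Submodule.smul_mem _ _ h

variable (p) in
/-- The restricted tensor product `⊗' (A v, p v)` of C⋆-algebras, for the spatial tensor product:
the closure of `A₀ = ⋃ A_F` for the spatial C⋆-norm, which is the norm of operators on
`⊗' (K v, k v)`, the algebras `A v` being faithfully represented on the Hilbert spaces `K v`. -/
def RestrictedAlgebra : Type _ := (algebraicTensor p).topologicalClosure

theorem isClosed_algebra :
    IsClosed ((algebraicTensor p).topologicalClosure : Set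
      (HilbertTensor p.unitVector →L[ℂ] HilbertTensor p.unitVector)) :=
  NonUnitalStarSubalgebra.isClosed_topologicalClosure _

noncomputable instance : NonUnitalCStarAlgebra (RestrictedAlgebra p) :=
  NonUnitalStarSubalgebra.nonUnitalCStarAlgebra (algebraicTensor p).topologicalClosure
    (h_closed := isClosed_algebra)

noncomputable instance : PartialOrder (RestrictedAlgebra p) :=
  inferInstanceAs (PartialOrder (algebraicTensor p).topologicalClosure)

/-- An element of the restricted tensor product as an operator. -/
def RestrictedAlgebra.toOp (a : RestrictedAlgebra p) :
    HilbertTensor p.unitVector →L[ℂ] HilbertTensor p.unitVector := a.1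

theorem RestrictedAlgebra.toOp_mul (a b : RestrictedAlgebra p) :
    (a * b).toOp = a.toOp * b.toOp := rfl

theorem RestrictedAlgebra.toOp_star (a : RestrictedAlgebra p) : (star a).toOp = star a.toOp := rfl

theorem RestrictedAlgebra.toOp_add (a b : RestrictedAlgebra p) :
    (a + b).toOp = a.toOp + b.toOp := rfl

theorem RestrictedAlgebra.toOp_smul (c : ℂ) (a : RestrictedAlgebra p) :
    (c • a).toOp = c • a.toOp := rfl

theorem RestrictedAlgebra.norm_toOp (a : RestrictedAlgebra p) : ‖a.toOp‖ = ‖a‖ := rfl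

theorem RestrictedAlgebra.toOp_injective :
    Function.Injective (RestrictedAlgebra.toOp (p := p)) := Subtype.val_injective

theorem RestrictedAlgebra.nonneg_iff (a : RestrictedAlgebra p) : 0 ≤ a ↔ 0 ≤ a.toOp := Iff.rfl

instance : StarOrderedRing (RestrictedAlgebra p) := by
  refine StarOrderedRing.of_nonneg_iff' (fun {x y} h z => ?_) fun x => ⟨fun h => ?_, ?_⟩
  · exact add_le_add_right (α := HilbertTensor p.unitVector →L[ℂ] HilbertTensor p.unitVector)
      (b := x.toOp) (c := y.toOp) h z.toOp
  · have hx : 0 ≤ x.toOp := h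
    have hmem : CFC.sqrt x.toOp ∈ (algebraicTensor p).topologicalClosure := by
      rw [CFC.sqrt_eq_real_sqrt x.toOp hx]
      exact cfcₙ_mem (hs := isClosed_algebra) Real.sqrt x.2
    refine ⟨(⟨CFC.sqrt x.toOp, hmem⟩ : (algebraicTensor p).topologicalClosure), ?_⟩
    apply RestrictedAlgebra.toOp_injective
    change x.toOp = star (CFC.sqrt x.toOp) * CFC.sqrt x.toOp
    rw [(IsSelfAdjoint.of_nonneg (CFC.sqrt_nonneg x.toOp)).star_eq, CFC.sqrt_mul_sqrt_self x.toOp hx]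
  · rintro ⟨s, rfl⟩
    exact star_mul_self_nonneg s.toOp

theorem simpleOp_mem {a : ∀ v, A v} (ha : ∀ᶠ v in cofinite, a v = p.toFun v) :
    simpleOp p a ∈ (algebraicTensor p).topologicalClosure :=
  NonUnitalStarSubalgebra.le_topologicalClosure _ (Submodule.subset_span ⟨a, ha, rfl⟩)

/-- The element of the restricted tensor product given by an operator in the closure of `A₀`. -/
def RestrictedAlgebra.ofOp (T : HilbertTensor p.unitVector →L[ℂ] HilbertTensor p.unitVector)
    (hT : T ∈ (algebraicTensor p).topologicalClosure) : RestrictedAlgebra p := ⟨T, hT⟩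

theorem RestrictedAlgebra.toOp_ofOp
    (T : HilbertTensor p.unitVector →L[ℂ] HilbertTensor p.unitVector)
    (hT : T ∈ (algebraicTensor p).topologicalClosure) :
    (RestrictedAlgebra.ofOp T hT).toOp = T := rfl

variable (p) in
open Classical in
/-- The simple tensor `⊗ a v` in `⊗' (A v, p v)`, for a family `a` with `a v = p v` for all but
finitely many `v` (and zero, as a junk value, for all other families). -/
noncomputable def RestrictedAlgebra.tprod (a : ∀ v, A v) : RestrictedAlgebra p :=
  if ha : ∀ᶠ v in cofinite, a v = p.toFun v then
    RestrictedAlgebra.ofOp (simpleOp p a) (simpleOp_mem ha) else 0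

theorem RestrictedAlgebra.toOp_tprod {a : ∀ v, A v} (ha : ∀ᶠ v in cofinite, a v = p.toFun v) :
    (RestrictedAlgebra.tprod p a).toOp = simpleOp p a := by
  rw [RestrictedAlgebra.tprod, dif_pos ha]; rfl

end Algebra
/-! ### Restricted tensor products of Hilbert modules -/

section Module

set_option linter.unusedSectionVars false

variable {I : Type*} {A : I → Type*} [∀ v, NonUnitalCStarAlgebra (A v)] [∀ v, PartialOrder (A v)]
  [∀ v, StarOrderedRing (A v)] {X : I → Type*} [∀ v, NormedAddCommGroup (X v)]
  [∀ v, NormedSpace ℂ (X v)] [∀ v, SMul (A v)ᵐᵒᵖ (X v)] [∀ v, CStarModule (A v)ᵐᵒᵖ (X v)]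

/-- Vectors `x v ∈ X v` which make the right Hilbert `A v`-modules `X v` a compatible collection
with respect to the projections `p v`: `⟨x v, x v⟩ = p v` for all but finitely many `v`. -/
structure CompatibleVectors {I : Type*} {A : I → Type*} [∀ v, NonUnitalCStarAlgebra (A v)]
    (p : ProjectionFamily A) (X : I → Type*) [∀ v, Inner (A v)ᵐᵒᵖ (X v)] where
  /-- The vectors. -/
  toFun : ∀ v, X v
  /-- The compatibility condition. -/
  eventually_rinner : ∀ᶠ v in cofinite, rinner (A v) (toFun v) (toFun v) = p.toFun v

variable {p : ProjectionFamily A} (x : CompatibleVectors p X)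

/-- The vectors `x v ⊗ k v` in `X v ⊗ K v`, where `k v` is the chosen unit vector with
`σ v (p v) (k v) = k v` in the space `K v` of the universal representation `σ v` of `A v`. -/
noncomputable def CompatibleVectors.tensorVector (v : I) :
    InteriorTensor (X v) (universalRep (A v)) :=
  InteriorTensor.tmul _ (x.toFun v) (p.unitVector v)

/-- The operator `⊗ e v ↦ ⊗ (w v ⊗ e v)` from `⊗' (K v, k v)` to
`⊗' (X v ⊗ K v, x v ⊗ k v)`, where `A v` is represented on `K v` by its universal
representation. -/
noncomputable def creationOp (w : ∀ v, X v) :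
    HilbertTensor p.unitVector →L[ℂ] HilbertTensor x.tensorVector :=
  HilbertTensor.map p.unitVector x.tensorVector
    fun v => InteriorTensor.creation (universalRep (A v)) (w v)

variable {x}

theorem CompatibleVectors.eventually_norm_tmul {H : I → Type*} [∀ v, NormedAddCommGroup (H v)]
    [∀ v, InnerProductSpace ℂ (H v)] [∀ v, CompleteSpace (H v)]
    (x : CompatibleVectors p X) (π : ∀ v, A v →⋆ₙₐ[ℂ] (H v →L[ℂ] H v)) {h : ∀ v, H v}
    (hh : ∀ᶠ v in cofinite, ‖h v‖ = 1 ∧ π v (p.toFun v) (h v) = h v) :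
    ∀ᶠ v in cofinite, ‖InteriorTensor.tmul (π v) (x.toFun v) (h v)‖ = 1 := by
  filter_upwards [hh, x.eventually_rinner] with v h1 h2
  have h3 := InteriorTensor.inner_tmul (π v) (x.toFun v) (x.toFun v) (h v) (h v)
  rw [h2, h1.2, inner_self_eq_norm_sq_to_K, inner_self_eq_norm_sq_to_K, h1.1] at h3
  norm_cast at h3
  nlinarith [norm_nonneg (InteriorTensor.tmul (π v) (x.toFun v) (h v)), h3.trans Nat.cast_one]

theorem CompatibleVectors.eventually_norm :
    ∀ᶠ v in cofinite, ‖x.tensorVector v‖ = 1 :=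
  x.eventually_norm_tmul (fun v => universalRep (A v)) p.eventually_unitVector

theorem eventually_creation {w : ∀ v, X v} (hw : ∀ᶠ v in cofinite, w v = x.toFun v) :
    ∀ᶠ v in cofinite, InteriorTensor.creation (universalRep (A v)) (w v) (p.unitVector v)
        = x.tensorVector v ∧ ‖InteriorTensor.creation (universalRep (A v)) (w v)‖ ≤ 1 := by
  filter_upwards [hw, x.eventually_rinner] with v h1 h2
  rw [h1]
  refine ⟨rfl, (InteriorTensor.norm_creation_le _ _).trans ?_⟩
  have h3 := norm_rinner_self (A := A v) (x.toFun v)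
  rw [h2] at h3
  have h4 := p.norm_le v
  nlinarith [norm_nonneg (x.toFun v)]

theorem creationOp_tprod {w : ∀ v, X v} (hw : ∀ᶠ v in cofinite, w v = x.toFun v)
    {e : ∀ v, UniversalSpace (A v)} (he : ∀ᶠ v in cofinite, e v = p.unitVector v) :
    creationOp x w (HilbertTensor.tprod _ e)
      = HilbertTensor.tprod _ fun v => InteriorTensor.tmul (universalRep (A v)) (w v) (e v) :=
  HilbertTensor.map_tprod (eventually_creation hw) p.eventually_norm he

theorem eventually_tmul {w : ∀ v, X v} (hw : ∀ᶠ v in cofinite, w v = x.toFun v)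
    {e : ∀ v, UniversalSpace (A v)} (he : ∀ᶠ v in cofinite, e v = p.unitVector v) :
    ∀ᶠ v in cofinite, InteriorTensor.tmul (universalRep (A v)) (w v) (e v) = x.tensorVector v := by
  filter_upwards [hw, he] with v h1 h2
  rw [h1, h2]; rfl

theorem eventually_rinner {w z : ∀ v, X v} (hw : ∀ᶠ v in cofinite, w v = x.toFun v)
    (hz : ∀ᶠ v in cofinite, z v = x.toFun v) :
    ∀ᶠ v in cofinite, rinner (A v) (w v) (z v) = p.toFun v := by
  filter_upwards [hw, hz, x.eventually_rinner] with v h1 h2 h3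
  rw [h1, h2, h3]

theorem eventually_smul {w : ∀ v, X v} (hw : ∀ᶠ v in cofinite, w v = x.toFun v)
    {a : ∀ v, A v} (ha : ∀ᶠ v in cofinite, a v = p.toFun v) :
    ∀ᶠ v in cofinite, MulOpposite.op (a v) • w v = x.toFun v := by
  filter_upwards [hw, ha, x.eventually_rinner] with v h1 h2 h3
  rw [h1, h2, ← sub_eq_zero, ← CStarModule.inner_self (A := (A v)ᵐᵒᵖ)]
  apply MulOpposite.unop_injective
  have h4 : ∀ y z : X v, (inner (A v)ᵐᵒᵖ y z).unop = rinner (A v) y z := fun _ _ => rfl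
  have h5 := (p.isStarProjection v).isIdempotentElem.eq
  have h6 := (p.isStarProjection v).isSelfAdjoint.star_eq
  rw [CStarModule.inner_sub_left, CStarModule.inner_sub_right, CStarModule.inner_sub_right]
  simp only [MulOpposite.unop_sub, h4, rinner_smul_left, rinner_smul_right, h3, h5, h6,
    sub_self, MulOpposite.unop_zero]

theorem adjoint_creationOp_comp {w z : ∀ v, X v} (hw : ∀ᶠ v in cofinite, w v = x.toFun v)
    (hz : ∀ᶠ v in cofinite, z v = x.toFun v) :
    ContinuousLinearMap.adjoint (creationOp x w) ∘L creationOp x z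
      = simpleOp p fun v => rinner (A v) (w v) (z v) := by
  refine HilbertTensor.ext_clm fun e he => HilbertTensor.ext_inner fun f hf => ?_
  rw [ContinuousLinearMap.comp_apply, ContinuousLinearMap.adjoint_inner_right,
    creationOp_tprod hw hf, creationOp_tprod hz he, simpleOp_tprod (eventually_rinner hw hz) he,
    HilbertTensor.inner_tprod x.eventually_norm (eventually_tmul hw hf) (eventually_tmul hz he),
    HilbertTensor.inner_tprod p.eventually_norm hf
      (eventually_rep_apply (eventually_rinner hw hz) he)]
  exact finprod_congr fun v => InteriorTensor.inner_tmul _ _ _ _ _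

theorem creationOp_comp {w : ∀ v, X v} (hw : ∀ᶠ v in cofinite, w v = x.toFun v)
    {a : ∀ v, A v} (ha : ∀ᶠ v in cofinite, a v = p.toFun v) :
    creationOp x w ∘L simpleOp p a = creationOp x fun v => MulOpposite.op (a v) • w v := by
  refine HilbertTensor.ext_clm fun e he => ?_
  rw [ContinuousLinearMap.comp_apply, simpleOp_tprod ha he,
    creationOp_tprod hw (eventually_rep_apply ha he), creationOp_tprod (eventually_smul hw ha) he]
  simp only [InteriorTensor.tmul_smul]

variable (x) in
/-- The span `X₀` of the simple tensors `⊗ w v` (where `w v = x v` for all but finitely many `v`),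
realised as operators. -/
noncomputable def algebraicModule :
    Submodule ℂ (HilbertTensor p.unitVector →L[ℂ] HilbertTensor x.tensorVector) :=
  Submodule.span ℂ {T | ∃ w : ∀ v, X v, (∀ᶠ v in cofinite, w v = x.toFun v) ∧ creationOp x w = T}

variable (x) in
/-- The restricted tensor product `⊗' (X v, x v)` of a compatible collection of right Hilbert
modules: the completion of `X₀` for the norm `‖⟨w, w⟩‖ ^ (1 / 2)` given by its inner product
`⟨⊗ w v, ⊗ z v⟩ = ⊗ ⟨w v, z v⟩` with values in `⊗' (A v, p v)`. Since `⟨S, T⟩ = S† T` for `X₀`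
realised as operators (see `RestrictedModule.rinner_tprod`), that norm is the operator norm, and the
completion is the closure of `X₀`. -/
def RestrictedModule : Type _ := (algebraicModule x).topologicalClosure

noncomputable instance : NormedAddCommGroup (RestrictedModule x) :=
  inferInstanceAs (NormedAddCommGroup (algebraicModule x).topologicalClosure)

noncomputable instance : NormedSpace ℂ (RestrictedModule x) :=
  inferInstanceAs (NormedSpace ℂ (algebraicModule x).topologicalClosure)

instance : CompleteSpace (RestrictedModule x) :=
  (Submodule.isClosed_topologicalClosure (algebraicModule x)).completeSpace_coe

/-- An element of the restricted tensor product as an operator. -/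
def RestrictedModule.toOp (w : RestrictedModule x) :
    HilbertTensor p.unitVector →L[ℂ] HilbertTensor x.tensorVector := w.1

/-- The element of the restricted tensor product given by an operator in the closure of `X₀`. -/
def RestrictedModule.ofOp (T : HilbertTensor p.unitVector →L[ℂ] HilbertTensor x.tensorVector)
    (hT : T ∈ (algebraicModule x).topologicalClosure) : RestrictedModule x := ⟨T, hT⟩

theorem RestrictedModule.toOp_ofOp
    (T : HilbertTensor p.unitVector →L[ℂ] HilbertTensor x.tensorVector)
    (hT : T ∈ (algebraicModule x).topologicalClosure) :
    (RestrictedModule.ofOp T hT).toOp = T := rfl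

theorem RestrictedModule.toOp_injective :
    Function.Injective (RestrictedModule.toOp (x := x)) := Subtype.val_injective

theorem RestrictedModule.toOp_add (w z : RestrictedModule x) :
    (w + z).toOp = w.toOp + z.toOp := rfl

theorem RestrictedModule.toOp_smul (c : ℂ) (w : RestrictedModule x) :
    (c • w).toOp = c • w.toOp := rfl

theorem RestrictedModule.norm_toOp (w : RestrictedModule x) : ‖w.toOp‖ = ‖w‖ := rfl

theorem adjoint_comp_mem
    {S T : HilbertTensor p.unitVector →L[ℂ] HilbertTensor x.tensorVector}
    (hS : S ∈ (algebraicModule x).topologicalClosure)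
    (hT : T ∈ (algebraicModule x).topologicalClosure) :
    ContinuousLinearMap.adjoint S ∘L T ∈ (algebraicTensor p).topologicalClosure := by
  refine map_mem_closure₂ (f := fun S T :
      HilbertTensor p.unitVector →L[ℂ] HilbertTensor x.tensorVector =>
      ContinuousLinearMap.adjoint S ∘L T) ?_ hS hT ?_
  · exact (ContinuousLinearMap.adjoint.continuous.comp continuous_fst).clm_comp continuous_snd
  · intro S hS T hT
    change _ ∈ Submodule.span ℂ _
    refine Submodule.span_induction₂ (p := fun S T _ _ =>
      ContinuousLinearMap.adjoint S ∘L T ∈ Submodule.span ℂ _) ?_ ?_ ?_ ?_ ?_ ?_ ?_ hS hT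
    · rintro _ _ ⟨w, hw, rfl⟩ ⟨z, hz, rfl⟩
      rw [adjoint_creationOp_comp hw hz]
      exact Submodule.subset_span ⟨_, eventually_rinner hw hz, rfl⟩
    · intro T _; rw [map_zero, ContinuousLinearMap.zero_comp]; exact Submodule.zero_mem _
    · intro S _; rw [ContinuousLinearMap.comp_zero]; exact Submodule.zero_mem _
    · intro S S' T _ _ _ h h'
      rw [map_add, ContinuousLinearMap.add_comp]; exact Submodule.add_mem _ h h'
    · intro S T T' _ _ _ h h'
      rw [ContinuousLinearMap.comp_add]; exact Submodule.add_mem _ h h'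
    · intro c S T _ _ h
      rw [map_smulₛₗ, ContinuousLinearMap.smul_comp]; exact Submodule.smul_mem _ _ h
    · intro c S T _ _ h
      rw [ContinuousLinearMap.comp_smul]; exact Submodule.smul_mem _ _ h

theorem comp_mem
    {S : HilbertTensor p.unitVector →L[ℂ] HilbertTensor x.tensorVector}
    {a : HilbertTensor p.unitVector →L[ℂ] HilbertTensor p.unitVector}
    (hS : S ∈ (algebraicModule x).topologicalClosure)
    (ha : a ∈ (algebraicTensor p).topologicalClosure) :
    S ∘L a ∈ (algebraicModule x).topologicalClosure := by
  refine map_mem_closure₂ (f := fun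
      (S : HilbertTensor p.unitVector →L[ℂ] HilbertTensor x.tensorVector)
      (a : HilbertTensor p.unitVector →L[ℂ] HilbertTensor p.unitVector) => S ∘L a) ?_ hS ha ?_
  · exact continuous_fst.clm_comp continuous_snd
  · intro S hS a ha
    change _ ∈ Submodule.span ℂ _
    refine Submodule.span_induction₂ (p := fun S a _ _ =>
      S ∘L a ∈ Submodule.span ℂ _) ?_ ?_ ?_ ?_ ?_ ?_ ?_ hS ha
    · rintro _ _ ⟨w, hw, rfl⟩ ⟨a, ha, rfl⟩
      rw [creationOp_comp hw ha]
      exact Submodule.subset_span ⟨_, eventually_smul hw ha, rfl⟩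
    · intro T _; rw [ContinuousLinearMap.zero_comp]; exact Submodule.zero_mem _
    · intro S _; rw [ContinuousLinearMap.comp_zero]; exact Submodule.zero_mem _
    · intro S S' T _ _ _ h h'
      rw [ContinuousLinearMap.add_comp]; exact Submodule.add_mem _ h h'
    · intro S T T' _ _ _ h h'
      rw [ContinuousLinearMap.comp_add]; exact Submodule.add_mem _ h h'
    · intro c S T _ _ h
      rw [ContinuousLinearMap.smul_comp]; exact Submodule.smul_mem _ _ h
    · intro c S T _ _ h
      rw [ContinuousLinearMap.comp_smul]; exact Submodule.smul_mem _ _ h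

/-- The right action of `⊗' (A v, p v)`, which is the composition of operators. -/
noncomputable instance : SMul (RestrictedAlgebra p)ᵐᵒᵖ (RestrictedModule x) where
  smul a w := .ofOp (w.toOp ∘L a.unop.toOp) (comp_mem w.2 a.unop.2)

theorem RestrictedModule.toOp_op_smul (a : RestrictedAlgebra p) (w : RestrictedModule x) :
    (MulOpposite.op a • w).toOp = w.toOp ∘L a.toOp := rfl

/-- The inner product `S† T` with values in `⊗' (A v, p v)`. -/
noncomputable def RestrictedModule.innerAux (w z : RestrictedModule x) : RestrictedAlgebra p :=
  .ofOp (ContinuousLinearMap.adjoint w.toOp ∘L z.toOp) (adjoint_comp_mem w.2 z.2)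

theorem RestrictedModule.toOp_innerAux (w z : RestrictedModule x) :
    (w.innerAux z).toOp = ContinuousLinearMap.adjoint w.toOp ∘L z.toOp := rfl

theorem RestrictedModule.norm_innerAux_self (w : RestrictedModule x) :
    ‖w.innerAux w‖ = ‖w‖ * ‖w‖ := by
  rw [← RestrictedAlgebra.norm_toOp, RestrictedModule.toOp_innerAux,
    ContinuousLinearMap.norm_adjoint_comp_self, RestrictedModule.norm_toOp]

/-- The structure of a right Hilbert module over `⊗' (A v, p v)`, with `⟨S, T⟩ = S† T`. -/
noncomputable instance : CStarModule (RestrictedAlgebra p)ᵐᵒᵖ (RestrictedModule x) where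
  inner w z := MulOpposite.op (w.innerAux z)
  inner_add_right {w y z} := by
    apply MulOpposite.unop_injective
    apply RestrictedAlgebra.toOp_injective
    exact ContinuousLinearMap.comp_add _ _ _
  inner_self_nonneg {w} := by
    change 0 ≤ (w.innerAux w).toOp
    rw [RestrictedModule.toOp_innerAux, ContinuousLinearMap.nonneg_iff_isPositive]
    exact ContinuousLinearMap.isPositive_adjoint_comp_self _
  inner_self {w} := by
    rw [MulOpposite.op_eq_zero_iff, ← norm_eq_zero, RestrictedModule.norm_innerAux_self,
      mul_self_eq_zero, norm_eq_zero]
  inner_op_smul_right {a w z} := by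
    apply MulOpposite.unop_injective
    apply RestrictedAlgebra.toOp_injective
    exact (ContinuousLinearMap.comp_assoc _ _ _).symm
  inner_smul_right_complex {c w z} := by
    apply MulOpposite.unop_injective
    apply RestrictedAlgebra.toOp_injective
    exact ContinuousLinearMap.comp_smul _ _ _
  star_inner w z := by
    apply MulOpposite.unop_injective
    apply RestrictedAlgebra.toOp_injective
    change star (ContinuousLinearMap.adjoint w.toOp ∘L z.toOp)
      = ContinuousLinearMap.adjoint z.toOp ∘L w.toOp
    rw [ContinuousLinearMap.star_eq_adjoint, ContinuousLinearMap.adjoint_comp,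
      ContinuousLinearMap.adjoint_adjoint]
  norm_eq_sqrt_norm_inner_self w := by
    rw [MulOpposite.norm_op, RestrictedModule.norm_innerAux_self,
      Real.sqrt_mul_self (norm_nonneg _)]

theorem RestrictedModule.toOp_rinner (w z : RestrictedModule x) :
    (rinner (RestrictedAlgebra p) w z).toOp = ContinuousLinearMap.adjoint w.toOp ∘L z.toOp := rfl

theorem creationOp_mem {w : ∀ v, X v} (hw : ∀ᶠ v in cofinite, w v = x.toFun v) :
    creationOp x w ∈ (algebraicModule x).topologicalClosure :=
  Submodule.le_topologicalClosure _ (Submodule.subset_span ⟨w, hw, rfl⟩)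

variable (x) in
open Classical in
/-- The simple tensor `⊗ w v` in `⊗' (X v, x v)`, for a family `w` with `w v = x v` for all but
finitely many `v` (and zero, as a junk value, for all other families). -/
noncomputable def RestrictedModule.tprod (w : ∀ v, X v) : RestrictedModule x :=
  if hw : ∀ᶠ v in cofinite, w v = x.toFun v then
    RestrictedModule.ofOp (creationOp x w) (creationOp_mem hw) else 0

theorem RestrictedModule.toOp_tprod {w : ∀ v, X v} (hw : ∀ᶠ v in cofinite, w v = x.toFun v) :
    (RestrictedModule.tprod x w).toOp = creationOp x w := by
  rw [RestrictedModule.tprod, dif_pos hw]; rfl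

/-- The inner product of simple tensors is `⟨⊗ w v, ⊗ z v⟩ = ⊗ ⟨w v, z v⟩`. -/
theorem RestrictedModule.rinner_tprod {w z : ∀ v, X v}
    (hw : ∀ᶠ v in cofinite, w v = x.toFun v) (hz : ∀ᶠ v in cofinite, z v = x.toFun v) :
    rinner (RestrictedAlgebra p) (RestrictedModule.tprod x w) (RestrictedModule.tprod x z)
      = RestrictedAlgebra.tprod p fun v => rinner (A v) (w v) (z v) := by
  apply RestrictedAlgebra.toOp_injective
  rw [RestrictedModule.toOp_rinner, RestrictedModule.toOp_tprod hw, RestrictedModule.toOp_tprod hz,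
    RestrictedAlgebra.toOp_tprod (eventually_rinner hw hz), adjoint_creationOp_comp hw hz]

/-- The right action on simple tensors is `(⊗ w v) (⊗ a v) = ⊗ (w v a v)`. -/
theorem RestrictedModule.op_tprod_smul_tprod {w : ∀ v, X v}
    (hw : ∀ᶠ v in cofinite, w v = x.toFun v) {a : ∀ v, A v}
    (ha : ∀ᶠ v in cofinite, a v = p.toFun v) :
    MulOpposite.op (RestrictedAlgebra.tprod p a) • RestrictedModule.tprod x w
      = RestrictedModule.tprod x fun v => MulOpposite.op (a v) • w v := by
  apply RestrictedModule.toOp_injective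
  rw [RestrictedModule.toOp_op_smul, RestrictedModule.toOp_tprod hw,
    RestrictedAlgebra.toOp_tprod ha, RestrictedModule.toOp_tprod (eventually_smul hw ha),
    creationOp_comp hw ha]

variable (p) in
/-- The representation `π` of `⊗' (A v, p v)` on `H` factorizes as
`(π, H) ≃ (⊗' π v, ⊗' (H v, h v))` by means of the unitary operator `T`: the distinguished vectors
`h v` are unit vectors with `π v (p v) (h v) = h v` for all but finitely many `v`, and `T` carries
`π (⊗ a v)` to the operator `⊗ y v ↦ ⊗ π v (a v) (y v)`. -/
structure IsFactorization {H : I → Type*} [∀ v, NormedAddCommGroup (H v)]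
    [∀ v, InnerProductSpace ℂ (H v)] [∀ v, CompleteSpace (H v)]
    {E : Type*} [NormedAddCommGroup E] [InnerProductSpace ℂ E] [CompleteSpace E]
    (π : RestrictedAlgebra p →⋆ₙₐ[ℂ] (E →L[ℂ] E))
    (π' : ∀ v, A v →⋆ₙₐ[ℂ] (H v →L[ℂ] H v)) (h : ∀ v, H v)
    (T : E ≃ₗᵢ[ℂ] HilbertTensor h) : Prop where
  /-- The condition on the distinguished vectors. -/
  eventually_fixed : ∀ᶠ v in cofinite, ‖h v‖ = 1 ∧ π' v (p.toFun v) (h v) = h v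
  /-- The operator `T` is an equivalence of representations. -/
  intertwines : ∀ a : ∀ v, A v, (∀ᶠ v in cofinite, a v = p.toFun v) →
    ∀ y : ∀ v, H v, (∀ᶠ v in cofinite, y v = h v) →
      T (π (RestrictedAlgebra.tprod p a) (T.symm (HilbertTensor.tprod h y)))
        = HilbertTensor.tprod h fun v => π' v (a v) (y v)

end Module
end RestrictedTensor

end

/-! A unitary between Hilbert spaces is the same thing as a matching of two total families with
equal Gram matrices. The families here are indexed by pairs (w, y) of admissible families: on one
side (⊗ w_v) ⊗ (⊗ y_v), on the other ⊗ (w_v ⊗ y_v).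

The Gram matrices agree because the inner product of X sends simple tensors to simple tensors, and π
acts factorwise on these: ⟨w ⊗ y, w' ⊗ y'⟩ = ⟨y, π(⟨w, w'⟩) y'⟩ = ∏ ⟨y_v, π_v(⟨w_v, w'_v⟩) y'_v⟩ = ∏
⟨w_v ⊗ y_v, w'_v ⊗ y'_v⟩. The products are finite since almost every x_v ⊗ h_v is a unit vector:
‖x_v ⊗ h_v‖² = ⟨h_v, π_v(p_v) h_v⟩ = ‖h_v‖² = 1 (`CompatibleVectors.eventually_norm_tmul`). Equal
Gram matrices make corresponding finite linear combinations equally long, so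
`exists_linearIsometryEquiv_of_inner_eq` needs no separate check that the map is well defined.

What remains is totality. In X ⊗_A H it follows from totality of simple tensors in X
(`RestrictedModule.dense_span_tprod`) and in the space of π, because x ⊗ k is linear and continuous
in each variable (`InteriorTensor.eq_top_of_tmul_mem`). In the target, the generators are tensors ⊗
u_v with arbitrary u_v in X_v ⊗ H_v, whereas only elementary u_v = w_v ⊗ y_v are available. Almost
all factors equal x_v ⊗ h_v and are elementary already; the others are approximated one at a time,
since a simple tensor is linear and continuous in each factor (`HilbertTensor.eq_top_of_tprod_mem`).
Totality on the left also gives uniqueness. -/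

section
open Filter Matrix
open scoped ComplexOrder InnerProductSpace

namespace RestrictedTensor

/-! ### Unitary operators from equal Gram matrices -/

/-- Two total families of vectors with the same inner products are carried to each other by a
unitary operator. -/
theorem exists_linearIsometryEquiv_of_inner_eq {S E F : Type*}
    [NormedAddCommGroup E] [InnerProductSpace ℂ E] [CompleteSpace E]
    [NormedAddCommGroup F] [InnerProductSpace ℂ F] [CompleteSpace F] (f : S → E) (g : S → F)
    (hfg : ∀ s t, ⟪f s, f t⟫_ℂ = ⟪g s, g t⟫_ℂ)
    (hf : (Submodule.span ℂ (Set.range f)).topologicalClosure = ⊤)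
    (hg : (Submodule.span ℂ (Set.range g)).topologicalClosure = ⊤) :
    ∃ U : E ≃ₗᵢ[ℂ] F, ∀ s, U (f s) = g s := by
  have hf' : DenseRange (Finsupp.linearCombination ℂ f) := by
    rwa [← Submodule.dense_iff_topologicalClosure_eq_top,
      ← Finsupp.range_linearCombination] at hf
  have hg' : DenseRange (Finsupp.linearCombination ℂ g) := by
    rwa [← Submodule.dense_iff_topologicalClosure_eq_top,
      ← Finsupp.range_linearCombination] at hg
  have hgram : Matrix.gram ℂ g = Matrix.gram ℂ f := by
    ext s t
    exact (hfg s t).symm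
  -- Both squared norms are the quadratic form of the common Gram matrix at `c`. The coefficient
  -- space thus maps densely into `E` and into `F` with the same seminorm, and its identity map
  -- extends to the unitary.
  have hnorm : ∀ c, ‖Finsupp.linearCombination ℂ g (LinearEquiv.refl ℂ (S →₀ ℂ) c)‖
      = ‖Finsupp.linearCombination ℂ f c‖ := fun c => by
    rw [← sq_eq_sq₀ (norm_nonneg _) (norm_nonneg _), ← inner_self_eq_norm_sq (𝕜 := ℂ),
      ← inner_self_eq_norm_sq (𝕜 := ℂ), ← kernelForm_gram, LinearEquiv.refl_apply,
      ← kernelForm_gram, hgram]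
  refine ⟨(LinearEquiv.refl ℂ (S →₀ ℂ)).extendOfIsometry (Finsupp.linearCombination ℂ f)
    (Finsupp.linearCombination ℂ g) hf' hg' hnorm, fun s => ?_⟩
  have := LinearEquiv.extendOfIsometry_eq (LinearEquiv.refl ℂ (S →₀ ℂ))
    (Finsupp.linearCombination ℂ f) (Finsupp.linearCombination ℂ g) hf' hg' hnorm
    (Finsupp.single s 1)
  simpa using this

/-! ### Multilinearity and totality of simple tensors of Hilbert spaces -/

section HilbertTensor

variable {I : Type*} {H : I → Type*} {h : ∀ v, H v}

theorem eventually_update [DecidableEq I] {e : ∀ v, H v} (he : ∀ᶠ v in cofinite, e v = h v)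
    (i : I) (u : H i) : ∀ᶠ v in cofinite, Function.update e i u v = h v := by
  filter_upwards [he, (Set.finite_singleton i).compl_mem_cofinite] with v h1 h2
  rw [Function.update_of_ne (by simpa using h2), h1]

variable [∀ v, NormedAddCommGroup (H v)] [∀ v, InnerProductSpace ℂ (H v)]

theorem HilbertTensor.dense_span_vec :
    (Submodule.span ℂ (Set.range (HilbertTensor.vec (h := h)))).topologicalClosure = ⊤ :=
  KernelSpace.dense_span (restrictedKernel h) (restrictedKernel_posSemidef h)

/-- Splitting off the factor at `i` leaves a coefficient free of `u`, so the pairing with a fixed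
simple tensor is visibly linear in `u`. The same formula yields the norm of the updated tensor. -/
theorem HilbertTensor.inner_tprod_update [DecidableEq I] (hh : ∀ᶠ v in cofinite, ‖h v‖ = 1)
    {e f : ∀ v, H v} (he : ∀ᶠ v in cofinite, e v = h v) (hf : ∀ᶠ v in cofinite, f v = h v)
    (i : I) (u : H i) :
    ⟪HilbertTensor.tprod h f, HilbertTensor.tprod h (Function.update e i u)⟫_ℂ
      = ⟪f i, u⟫_ℂ * ∏ᶠ (v) (_ : v ≠ i), ⟪f v, e v⟫_ℂ := by
  rw [HilbertTensor.inner_tprod hh hf (eventually_update he i u), ← mul_finprod_cond_ne i,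
    Function.update_self]
  · congr 1
    refine finprod_congr fun v => finprod_congr fun hv => ?_
    rw [Function.update_of_ne hv]
  -- Splitting a factor off a `finprod` requires finite multiplicative support; almost every factor
  -- is ⟨h_v, h_v⟩ = 1.
  · have : ∀ᶠ v in cofinite, ⟪f v, Function.update e i u v⟫_ℂ = 1 := by
      filter_upwards [hh, hf, eventually_update he i u] with v h1 h2 h3
      rw [h2, h3, inner_self_eq_norm_sq_to_K, h1]
      simp
    exact this

/-- A simple tensor depends linearly and continuously on each of its factors. -/
theorem HilbertTensor.exists_clm_tprod_update [DecidableEq I]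
    (hh : ∀ᶠ v in cofinite, ‖h v‖ = 1) {e : ∀ v, H v} (he : ∀ᶠ v in cofinite, e v = h v) (i : I) :
    ∃ L : H i →L[ℂ] HilbertTensor h,
      ∀ u, L u = HilbertTensor.tprod h (Function.update e i u) := by
  let L₀ : H i →ₗ[ℂ] HilbertTensor h :=
    { toFun := fun u => HilbertTensor.tprod h (Function.update e i u)
      -- Simple tensors separate vectors, so linearity only has to be tested in inner products
      -- against them.
      map_add' := fun u w => HilbertTensor.ext_inner fun f hf => by
        simp only [inner_add_right, HilbertTensor.inner_tprod_update hh he hf, add_mul]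
      map_smul' := fun c u => HilbertTensor.ext_inner fun f hf => by
        simp only [inner_smul_right, HilbertTensor.inner_tprod_update hh he hf, RingHom.id_apply,
          mul_assoc] }
  -- The map is a multiple of an isometry: the other factors contribute a constant. Taking the
  -- modulus of their product avoids proving that it is real and nonnegative; its square root is the
  -- bound used below.
  have key : ∀ u, ‖L₀ u‖ ^ 2 = ‖u‖ ^ 2 * ‖∏ᶠ (v) (_ : v ≠ i), ⟪e v, e v⟫_ℂ‖ := by
    intro u
    have h1 : ⟪L₀ u, L₀ u⟫_ℂ = ⟪u, u⟫_ℂ * ∏ᶠ (v) (_ : v ≠ i), ⟪e v, e v⟫_ℂ := by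
      refine (HilbertTensor.inner_tprod_update hh he (eventually_update he i u) i u).trans ?_
      rw [Function.update_self]
      congr 1
      refine finprod_congr fun v => finprod_congr fun hv => ?_
      rw [Function.update_of_ne hv]
    have h2 := congrArg norm h1
    rwa [norm_mul, inner_self_eq_norm_sq_to_K, inner_self_eq_norm_sq_to_K, norm_pow, norm_pow,
      RCLike.norm_ofReal, RCLike.norm_ofReal, abs_norm, abs_norm] at h2
  refine ⟨L₀.mkContinuous (√‖∏ᶠ (v) (_ : v ≠ i), ⟪e v, e v⟫_ℂ‖) fun u => ?_, fun u => rfl⟩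
  rw [← sq_le_sq₀ (norm_nonneg _) (by positivity), key, mul_pow, Real.sq_sqrt (norm_nonneg _),
    mul_comm]

/-- The simple tensors with factors in total sets are total. -/
theorem HilbertTensor.eq_top_of_tprod_mem (hh : ∀ᶠ v in cofinite, ‖h v‖ = 1)
    (G : ∀ v, Set (H v)) (hG : ∀ v, (Submodule.span ℂ (G v)).topologicalClosure = ⊤)
    (hhG : ∀ v, h v ∈ G v) {M : Submodule ℂ (HilbertTensor h)}
    (hMc : IsClosed (M : Set (HilbertTensor h)))
    (hM : ∀ e : ∀ v, H v, (∀ᶠ v in cofinite, e v = h v) → (∀ v, e v ∈ G v) →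
      HilbertTensor.tprod h e ∈ M) : M = ⊤ := by
  classical
  -- `F` holds the indices whose factor is still unrestricted. Induction on `F` frees one factor at
  -- a time, with `e` quantified inside so that it may be updated.
  have key : ∀ F : Finset I, ∀ e : ∀ v, H v, (∀ᶠ v in cofinite, e v = h v) →
      (∀ v ∉ F, e v ∈ G v) → HilbertTensor.tprod h e ∈ M := by
    intro F
    induction F using Finset.induction_on with
    | empty => exact fun e he heG => hM e he fun v => heG v (Finset.notMem_empty v)
    | insert i F hi ih =>
      intro e he heG
      obtain ⟨L, hL⟩ := HilbertTensor.exists_clm_tprod_update hh he i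
      -- With the other factors fixed, the vectors at `i` that lead into `M` form a closed subspace.
      -- It contains `G i` by the induction hypothesis, hence everything.
      have h1 : (Submodule.span ℂ (G i)).topologicalClosure
          ≤ M.comap (L : H i →ₗ[ℂ] HilbertTensor h) := by
        refine Submodule.topologicalClosure_minimal _ (Submodule.span_le.mpr fun u hu => ?_)
          (hMc.preimage L.continuous)
        change L u ∈ M
        rw [hL]
        refine ih _ (eventually_update he i u) fun v hv => ?_
        by_cases hvi : v = i
        · subst hvi
          rwa [Function.update_self]
        · rw [Function.update_of_ne hvi]
          exact heG v (by simp [hv, hvi])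
      rw [hG i] at h1
      have h2 : L (e i) ∈ M := h1 Submodule.mem_top
      rwa [hL, Function.update_eq_self] at h2
  rw [eq_top_iff, ← HilbertTensor.dense_span_vec]
  refine Submodule.topologicalClosure_minimal _ (Submodule.span_le.mpr ?_) hMc
  rintro _ ⟨e, rfl⟩
  -- Here `h v ∈ G v` matters: outside this finite set the factors lie in `G v` automatically, so a
  -- finite induction suffices.
  have hfin : {v | ¬ e.1 v = h v}.Finite := e.2
  have := key hfin.toFinset e.1 e.2 fun v hv => by
    simp only [Set.Finite.mem_toFinset, Set.mem_ofPred_eq, not_not] at hv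
    exact hv ▸ hhG v
  rwa [HilbertTensor.tprod_family] at this

end HilbertTensor

/-! ### Totality of elementary tensors in interior tensor products -/

section InteriorTensor

variable {A X H : Type*} [NonUnitalCStarAlgebra A] [PartialOrder A] [StarOrderedRing A]
  [NormedAddCommGroup X] [NormedSpace ℂ X] [SMul Aᵐᵒᵖ X] [CStarModule Aᵐᵒᵖ X]
  [NormedAddCommGroup H] [InnerProductSpace ℂ H] [CompleteSpace H]

theorem InteriorTensor.dense_span_tmul (π : A →⋆ₙₐ[ℂ] (H →L[ℂ] H)) :
    (Submodule.span ℂ (Set.range fun s : X × H =>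
      InteriorTensor.tmul π s.1 s.2)).topologicalClosure = ⊤ :=
  KernelSpace.dense_span (interiorKernel π X) (interiorKernel_posSemidef π)

/-- Tensoring with `h`, as an operator from `X` to `X ⊗_A H`. -/
theorem InteriorTensor.exists_clm_tmul_left (π : A →⋆ₙₐ[ℂ] (H →L[ℂ] H)) (h : H) :
    ∃ L : X →L[ℂ] InteriorTensor X π, ∀ x, L x = InteriorTensor.tmul π x h := by
  have hadd : ∀ y x z : X, rinner A y (x + z) = rinner A y x + rinner A y z := fun y x z => by
    simp [rinner, CStarModule.inner_add_right]
  have hsmul : ∀ (c : ℂ) (y x : X), rinner A y (c • x) = c • rinner A y x := fun c y x => by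
    simp [rinner, CStarModule.inner_smul_right_complex]
  refine ⟨LinearMap.mkContinuous
    { toFun := fun x => InteriorTensor.tmul π x h
      map_add' := fun x z => InteriorTensor.ext_inner π fun y k => by
        simp only [inner_add_right, InteriorTensor.inner_tmul, hadd, map_add,
          _root_.add_apply]
      map_smul' := fun c x => InteriorTensor.ext_inner π fun y k => by
        simp only [inner_smul_right, InteriorTensor.inner_tmul, hsmul, map_smul,
          _root_.smul_apply, RingHom.id_apply] } ‖h‖ fun x => ?_,
    fun x => rfl⟩
  -- The estimate ‖x ⊗ h‖ ≤ ‖x‖ ‖h‖ from `creation` serves again, now with `h` fixed and `x`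
  -- varying.
  rw [mul_comm]
  exact ((InteriorTensor.creation π x).le_opNorm h).trans
    (mul_le_mul_of_nonneg_right (InteriorTensor.norm_creation_le π x) (norm_nonneg h))

/-- The tensors of vectors in total sets are total. -/
theorem InteriorTensor.eq_top_of_tmul_mem (π : A →⋆ₙₐ[ℂ] (H →L[ℂ] H)) {G : Set X} {K : Set H}
    (hG : (Submodule.span ℂ G).topologicalClosure = ⊤)
    (hK : (Submodule.span ℂ K).topologicalClosure = ⊤) {M : Submodule ℂ (InteriorTensor X π)}
    (hMc : IsClosed (M : Set (InteriorTensor X π)))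
    (hM : ∀ x ∈ G, ∀ k ∈ K, InteriorTensor.tmul π x k ∈ M) : M = ⊤ := by
  -- The second factor is freed while `x` stays in `G`; afterwards `k` is arbitrary and the first
  -- factor can be freed.
  have h1 : ∀ x ∈ G, ∀ k, InteriorTensor.tmul π x k ∈ M := by
    intro x hx k
    have : (Submodule.span ℂ K).topologicalClosure
        ≤ M.comap (InteriorTensor.creation π x : H →ₗ[ℂ] InteriorTensor X π) :=
      Submodule.topologicalClosure_minimal _ (Submodule.span_le.mpr fun k hk => hM x hx k hk)
        (hMc.preimage (InteriorTensor.creation π x).continuous)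
    rw [hK] at this
    exact this (Submodule.mem_top (x := k))
  rw [eq_top_iff, ← InteriorTensor.dense_span_tmul π]
  refine Submodule.topologicalClosure_minimal _ (Submodule.span_le.mpr ?_) hMc
  rintro _ ⟨⟨x, k⟩, rfl⟩
  obtain ⟨L, hL⟩ := InteriorTensor.exists_clm_tmul_left (X := X) π k
  have : (Submodule.span ℂ G).topologicalClosure
      ≤ M.comap (L : X →ₗ[ℂ] InteriorTensor X π) := by
    refine Submodule.topologicalClosure_minimal _ (Submodule.span_le.mpr fun x hx => ?_)
      (hMc.preimage L.continuous)
    change L x ∈ M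
    rw [hL]
    exact h1 x hx k
  rw [hG] at this
  have h2 : L x ∈ M := this Submodule.mem_top
  rwa [hL] at h2

end InteriorTensor

/-! ### Totality of simple tensors in the restricted module -/

section Module

variable {I : Type*} {A : I → Type*} [∀ v, NonUnitalCStarAlgebra (A v)] [∀ v, PartialOrder (A v)]
  [∀ v, StarOrderedRing (A v)] {X : I → Type*} [∀ v, NormedAddCommGroup (X v)]
  [∀ v, NormedSpace ℂ (X v)] [∀ v, SMul (A v)ᵐᵒᵖ (X v)] [∀ v, CStarModule (A v)ᵐᵒᵖ (X v)]
  {p : ProjectionFamily A} (x : CompatibleVectors p X)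

/-- The module is the closure of X₀ among operators, but density is needed inside the module itself.
Its topology is induced from the operators, so closures can be computed there, where the span of the
simple tensors maps onto a space containing X₀. -/
theorem RestrictedModule.dense_span_tprod :
    (Submodule.span ℂ {w : RestrictedModule x | ∃ z : ∀ v, X v,
      (∀ᶠ v in cofinite, z v = x.toFun v) ∧ RestrictedModule.tprod x z = w}).topologicalClosure
        = ⊤ := by
  let ι : RestrictedModule x →ₗ[ℂ]
      (HilbertTensor p.unitVector →L[ℂ] HilbertTensor x.tensorVector) :=
    { toFun := RestrictedModule.toOp
      map_add' := RestrictedModule.toOp_add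
      map_smul' := RestrictedModule.toOp_smul }
  have hι : Topology.IsInducing ι := Topology.IsInducing.subtypeVal
  rw [Submodule.eq_top_iff']
  intro w
  change w ∈ closure _
  rw [hι.closure_eq_preimage_closure_image, Set.mem_preimage]
  refine closure_mono ?_ w.2
  change algebraicModule x ≤ (Submodule.span ℂ _).map ι
  rw [Submodule.map_span]
  refine Submodule.span_le.mpr ?_
  rintro _ ⟨z, hz, rfl⟩
  exact Submodule.subset_span ⟨_, ⟨z, hz, rfl⟩, RestrictedModule.toOp_tprod hz⟩

end Module
end RestrictedTensor

end

/-! ### The unitary isomorphism -/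

open Filter RestrictedTensor in
open scoped InnerProductSpace in
-- The representation `π` lives on an abstract space `E`, so simple tensors of vectors enter the
-- left side through `T.symm`. Only admissible families are quantified over, so the junk value of
-- `tprod` plays no role.
theorem proposition4 {I : Type*} {A : I → Type*}
    [∀ v, NonUnitalCStarAlgebra (A v)] [∀ v, PartialOrder (A v)] [∀ v, StarOrderedRing (A v)]
    (p : RestrictedTensor.ProjectionFamily A)
    {X : I → Type*} [∀ v, NormedAddCommGroup (X v)] [∀ v, NormedSpace ℂ (X v)]
    [∀ v, CompleteSpace (X v)] [∀ v, SMul (A v)ᵐᵒᵖ (X v)] [∀ v, CStarModule (A v)ᵐᵒᵖ (X v)]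
    (x : RestrictedTensor.CompatibleVectors p X)
    {H : I → Type*} [∀ v, NormedAddCommGroup (H v)] [∀ v, InnerProductSpace ℂ (H v)]
    [∀ v, CompleteSpace (H v)] (π' : ∀ v, A v →⋆ₙₐ[ℂ] (H v →L[ℂ] H v)) (h : ∀ v, H v)
    {E : Type*} [NormedAddCommGroup E] [InnerProductSpace ℂ E] [CompleteSpace E]
    (π : RestrictedTensor.RestrictedAlgebra p →⋆ₙₐ[ℂ] (E →L[ℂ] E))
    (T : E ≃ₗᵢ[ℂ] RestrictedTensor.HilbertTensor h)
    (hT : RestrictedTensor.IsFactorization p π π' h T) :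
    (∀ᶠ v in Filter.cofinite,
      ‖RestrictedTensor.InteriorTensor.tmul (π' v) (x.toFun v) (h v)‖ = 1) ∧
    ∃! U : RestrictedTensor.InteriorTensor (RestrictedTensor.RestrictedModule x) π ≃ₗᵢ[ℂ]
        RestrictedTensor.HilbertTensor fun v =>
          RestrictedTensor.InteriorTensor.tmul (π' v) (x.toFun v) (h v),
      ∀ w : ∀ v, X v, (∀ᶠ v in Filter.cofinite, w v = x.toFun v) →
      ∀ y : ∀ v, H v, (∀ᶠ v in Filter.cofinite, y v = h v) →
        U (RestrictedTensor.InteriorTensor.tmul π (RestrictedTensor.RestrictedModule.tprod x w)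
            (T.symm (RestrictedTensor.HilbertTensor.tprod h y)))
          = RestrictedTensor.HilbertTensor.tprod _ fun v =>
              RestrictedTensor.InteriorTensor.tmul (π' v) (w v) (y v) := by
  have hh : ∀ᶠ v in cofinite, ‖h v‖ = 1 := hT.eventually_fixed.mono fun _ hv => hv.1
  have hx := x.eventually_norm_tmul π' hT.eventually_fixed
  -- The families w_v ⊗ y_v are admissible for the target, so their `tprod` is a genuine simple
  -- tensor.
  have htm : ∀ {w : ∀ v, X v} {y : ∀ v, H v}, (∀ᶠ v in cofinite, w v = x.toFun v) →
      (∀ᶠ v in cofinite, y v = h v) → ∀ᶠ v in cofinite,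
        InteriorTensor.tmul (π' v) (w v) (y v) = InteriorTensor.tmul (π' v) (x.toFun v) (h v) := by
    intro w y hw hy
    filter_upwards [hw, hy] with v h1 h2
    rw [h1, h2]
  let f : Family x.toFun × Family h → InteriorTensor (RestrictedModule x) π := fun s =>
    InteriorTensor.tmul π (RestrictedModule.tprod x s.1.1)
      (T.symm (HilbertTensor.tprod h s.2.1))
  let g : Family x.toFun × Family h →
      HilbertTensor fun v => InteriorTensor.tmul (π' v) (x.toFun v) (h v) := fun s =>
    HilbertTensor.tprod _ fun v => InteriorTensor.tmul (π' v) (s.1.1 v) (s.2.1 v)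
  have hfg : ∀ s t, ⟪f s, f t⟫_ℂ = ⟪g s, g t⟫_ℂ := by
    rintro ⟨⟨w, hw⟩, ⟨y, hy⟩⟩ ⟨⟨w', hw'⟩, ⟨y', hy'⟩⟩
    have hr := eventually_rinner hw hw'
    -- Almost everywhere this reads π_v(p_v) h_v = h_v, so the image under the factorized
    -- representation is again an admissible family.
    have hry : ∀ᶠ v in cofinite, π' v (rinner (A v) (w v) (w' v)) (y' v) = h v := by
      filter_upwards [hr, hy', hT.eventually_fixed] with v h1 h2 h3
      rw [h1, h2, h3.2]
    change ⟪InteriorTensor.tmul π _ _, InteriorTensor.tmul π _ _⟫_ℂ = _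
    -- Applying `T` to both entries turns π(⊗ ⟨w_v, w'_v⟩) into the factorwise action, after which
    -- both sides are products over `v`.
    rw [InteriorTensor.inner_tmul, RestrictedModule.rinner_tprod hw hw', ← T.inner_map_map,
      hT.intertwines _ hr _ hy', T.apply_symm_apply, HilbertTensor.inner_tprod hh hy hry,
      HilbertTensor.inner_tprod hx (htm hw hy) (htm hw' hy')]
    exact finprod_congr fun v => (InteriorTensor.inner_tmul _ _ _ _ _).symm
  have hf : (Submodule.span ℂ (Set.range f)).topologicalClosure = ⊤ := by
    -- Totality of simple tensors is carried back to `E` by the unitary `T.symm`.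
    have hE : (Submodule.span ℂ (Set.range fun e : Family h =>
        T.symm (HilbertTensor.vec e))).topologicalClosure = ⊤ := by
      have h1 := HilbertTensor.dense_span_vec (h := h)
      rw [← Submodule.dense_iff_topologicalClosure_eq_top] at h1 ⊢
      have h2 := T.symm.surjective.denseRange.dense_image T.symm.continuous h1
      refine h2.mono ?_
      rintro _ ⟨u, hu, rfl⟩
      refine Submodule.span_induction (p := fun u _ => T.symm u ∈ Submodule.span ℂ _)
        ?_ ?_ ?_ ?_ hu
      · rintro _ ⟨e, rfl⟩
        exact Submodule.subset_span ⟨e, rfl⟩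
      · rw [map_zero]; exact Submodule.zero_mem _
      · intro a b _ _ ha hb
        rw [map_add]; exact Submodule.add_mem _ ha hb
      · intro c a _ ha
        rw [map_smul]; exact Submodule.smul_mem _ c ha
    refine InteriorTensor.eq_top_of_tmul_mem π (RestrictedModule.dense_span_tprod x) hE
      (Submodule.isClosed_topologicalClosure _) ?_
    rintro _ ⟨w, hw, rfl⟩ _ ⟨e, rfl⟩
    refine Submodule.le_topologicalClosure _ (Submodule.subset_span ⟨(⟨w, hw⟩, e), ?_⟩)
    change InteriorTensor.tmul π _ (T.symm (HilbertTensor.tprod h e.1)) = _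
    rw [HilbertTensor.tprod_family]
  have hg : (Submodule.span ℂ (Set.range g)).topologicalClosure = ⊤ := by
    refine HilbertTensor.eq_top_of_tprod_mem hx
      (fun v => Set.range fun s : X v × H v => InteriorTensor.tmul (π' v) s.1 s.2)
      (fun v => InteriorTensor.dense_span_tmul (π' v)) (fun v => ⟨(x.toFun v, h v), rfl⟩)
      (Submodule.isClosed_topologicalClosure _) fun e he heG => ?_
    -- An elementary tensor does not determine its two vectors. The pair (x_v, h_v) must be picked
    -- whenever it represents `e v`, since otherwise the chosen families need not agree with `x` and
    -- `h` almost everywhere.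
    have : ∀ v, ∃ s : X v × H v, InteriorTensor.tmul (π' v) s.1 s.2 = e v ∧
        (e v = InteriorTensor.tmul (π' v) (x.toFun v) (h v) → s = (x.toFun v, h v)) := by
      intro v
      by_cases hv : e v = InteriorTensor.tmul (π' v) (x.toFun v) (h v)
      · exact ⟨(x.toFun v, h v), hv.symm, fun _ => rfl⟩
      · obtain ⟨s, hs⟩ := heG v
        exact ⟨s, hs, fun hv' => absurd hv' hv⟩
    choose s hs hsx using this
    refine Submodule.le_topologicalClosure _ (Submodule.subset_span
      ⟨(⟨fun v => (s v).1, ?_⟩, ⟨fun v => (s v).2, ?_⟩), ?_⟩)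
    · filter_upwards [he] with v hv
      rw [hsx v hv]
    · filter_upwards [he] with v hv
      rw [hsx v hv]
    · exact congrArg (HilbertTensor.tprod _) (funext hs)
  refine ⟨hx, ?_⟩
  obtain ⟨U, hU⟩ := exists_linearIsometryEquiv_of_inner_eq f g hfg hf hg
  refine ⟨U, fun w hw y hy => hU (⟨w, hw⟩, ⟨y, hy⟩), fun V hV => ?_⟩
  -- Uniqueness: `U` and `V` are bounded and agree on the total family `f`.
  have hVU : V.toContinuousLinearEquiv.toContinuousLinearMap
      = U.toContinuousLinearEquiv.toContinuousLinearMap := by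
    refine ContinuousLinearMap.ext_on (s := Set.range f)
      (Submodule.dense_iff_topologicalClosure_eq_top.mpr hf) ?_
    rintro _ ⟨⟨⟨w, hw⟩, ⟨y, hy⟩⟩, rfl⟩
    exact (hV w hw y hy).trans (hU (⟨w, hw⟩, ⟨y, hy⟩)).symm
  exact LinearIsometryEquiv.ext fun u => DFunLike.congr_fun hVU u
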